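/- For $n,m\in\mathbb N$, reals $\epsilon,\delta$, and a binary $n\times m$ matrix $D$, call $D$ an *$(n,m,\epsilon,\delta)$-distinguisher* if for all row vectors $x,y\in\mathbb F_2^n$ $$d_H(x,y)\ge \epsilon n\ \Longrightarrow\ d_H(xD,yD)\ge\delta m ,$$ where $d_H$ is the Hamming distance. The *weight* of $D$ is the maximum Hamming weight of a column of $D$. 1. Let $0<\epsilon\le 1$ be a real number that is rational or, more generally, such that $\lceil 2n^\epsilon\rceil$ can be computed from $n\in\mathbb N$ in time polynomial in $n$. Then there is an algorithm that, given $n\ge 1$, computes in time polynomial in $n$, for some $1\le m\le n^7$, an $(n,m,n^{-\epsilon},1/8)$-distinguisher of weight at most $\lceil 2n^\epsilon\rceil$. 2. For all sufficiently large naturals $w,n$ and all reals $\epsilon,\delta>0$ with $\delta\le \frac14\left(1-\frac1{\epsilon w}\right)$ there exists an $(n,m,\epsilon,\delta)$-distinguisher of weight at most $w$ with $1\le m\le n^7$. 3. There is an algorithm that, given sufficiently large $w<n$, outputs in time polynomial in $n+w$ a binary $n\times m$ matrix $D$ with $1\le m\le n^7$, of weight at most $w$, that is an $(n,m,\epsilon,\delta)$-distinguisher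 simultaneously for all reals $\epsilon,\delta>0$ with $\delta\le\frac14\left(1-\frac1{\epsilon w}\right)$. Here an algorithm is a deterministic multi-tape Turing machine. -/

import Mathlib

/-- A binary matrix together with its dimensions: an `n × m` matrix over the two-element field. -/
abbrev BinMatrix : Type := Σ n m : ℕ, Matrix (Fin n) (Fin m) (ZMod 2)

/-- `D` is an `(n, m, ε, δ)`-distinguisher: row vectors at Hamming distance at least `ε n`
are mapped by `x ↦ x D` to row vectors at Hamming distance at least `δ m`. -/
def IsDistinguisher {n m : ℕ} (D : Matrix (Fin n) (Fin m) (ZMod 2)) (ε δ : ℝ) : Prop :=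
  ∀ x y : Fin n → ZMod 2,
    ε * (n : ℝ) ≤ (hammingDist x y : ℝ) →
      δ * (m : ℝ) ≤ (hammingDist (Matrix.vecMul x D) (Matrix.vecMul y D) : ℝ)

/-- The weight of a binary matrix: the maximum Hamming weight of a column. -/
def columnWeight {n m : ℕ} (D : Matrix (Fin n) (Fin m) (ZMod 2)) : ℕ :=
  Finset.univ.sup fun j : Fin m => hammingNorm fun i : Fin n => D i j

/-- The word `1ʷ 0 1ⁿ` for the pair `(w, n)`; its length is `w + n + 1`. -/
def encodeUnaryPair (p : ℕ × ℕ) : List Bool :=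
  Computability.unaryEncodeNat p.1 ++ false :: Computability.unaryEncodeNat p.2

/-- A binary matrix written entry by entry, row after row,
with the end-of-row marker `none` after each row. -/
def encodeBinMatrix (A : BinMatrix) : List (Option (ZMod 2)) :=
  (List.finRange A.1).flatMap fun i =>
    (List.finRange A.2.1).map (fun j => some (A.2.2 i j)) ++ [none]

/-- `f : ℕ → ℕ` is computed by a multi-stack Turing machine, in time polynomial in the value
of the argument (argument and value are written in unary). -/
def NatPolyTime (f : ℕ → ℕ) : Prop :=
  Nonempty (Turing.TM2ComputableInPolyTime
    Computability.unaryEncodeNat Computability.unaryEncodeNat f)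

/-- The matrix `F n` is computed from `n` by a multi-stack Turing machine, in time polynomial
in `n`. -/
def MatrixPolyTime (F : ℕ → BinMatrix) : Prop :=
  Nonempty (Turing.TM2ComputableInPolyTime Computability.unaryEncodeNat encodeBinMatrix F)

/-- The matrix `F (w, n)` is computed from `(w, n)` by a multi-stack Turing machine, in time
polynomial in `w + n`. -/
def MatrixPolyTime₂ (F : ℕ × ℕ → BinMatrix) : Prop :=
  Nonempty (Turing.TM2ComputableInPolyTime encodeUnaryPair encodeBinMatrix F)

/-!
# Explicit distinguishers of small weight

**The matrices.** Let `K` be a field with `q = 2 ^ r` elements, where `q` is between `c * n` and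
`2 * c * n` for a small constant `c`, and attach the elements of `K` to the rows `0, …, n - 1` as
evenly as possible (by taking codes modulo `n`). A column is given by `a, b, α, y` in `K`. The line
`i ↦ a + b * β i`, for distinct `β 0, …, β (w - 1)`, selects `w` rows, and the bit `l (y * α ^ i)`
is added to the `i`-th selected row, where `l : K → ZMod 2` is a nonzero additive functional. So the
weight is at most `w`, and there are `q ^ 4` columns. If `w ≥ n`, then the `i`-th selected row is
just row `i`, and there are `q ^ 2` columns.

**The distinguishing property.** By linearity, one has to count the columns on which the sum of the
rows in the support of `x` is nonzero. The points of a random line are pairwise independent, so the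
Cauchy–Schwarz inequality bounds from below the fraction of the lines that hit the support of `x`:
it is at least `μ / (1 + μ)`, where `μ` is the expected number of hits (`mul_sq_le_card_hit_mul`).
Given a hit, the sum in question is `l (y * g α)` for a nonzero polynomial `g` of degree less than
`w`; it is nonzero for half of the `y` unless `α` is one of the few roots of `g`
(`card_mul_le_two_mul_card_code`). The product of the two fractions is at least `(1 - 1 / μ) / 4`
if `c = 4`, and at least `1 / 8` if `c = 2` and `μ ≥ 2`; if `w ≥ n`, then no line is needed, and the
fraction is at least `1 / 4`. The number of columns is at most `n ^ 7` for `c = 4` if `n ≥ 16`, and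
for `c = 2` if `w > 2`; the only other case is `n = 1`, for which the matrix `(1)` is taken.

**The algorithm.** All numbers involved are bounded by polynomials in `n + w`, so unary arithmetic
is good enough, and the field is found by exhaustive search: its elements are binary polynomials,
coded by natural numbers below `q`, and the modulus is the least one for which there are no zero
divisors. Machines are put together from pieces of code (`Frag`) that act on counters, that is, on
stacks over a one-letter alphabet. The class `CounterPoly` of functions computed by such pieces in
polynomial time is closed under substitution (`CounterPoly.bind`) and under primitive recursion with
polynomially bounded intermediate values (`CounterPoly.prec`), and all operations needed are obtained
from these closure properties. A machine for the matrices reads `w` and `n` into counters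
(`InputPhase`) and then writes the entries one by one (`CounterPoly.exists_output`). For
`w = ⌈2 * n ^ ε⌉` with rational `ε`, the number `w` is computed by comparing integer powers; if
instead a machine for this function is given, it is called as a subroutine (`RegFrag.call`).
-/

/-! ### Fragments of stack machines -/

open Turing in
/-- `StepsIn m t a b`: the stack machine with code `m` goes from the configuration `a` to the
configuration `b` in exactly `t` steps. -/
inductive StepsIn {K : Type} [DecidableEq K] {Γ : K → Type} {Λ σ : Type}
    (m : Λ → TM2.Stmt Γ Λ σ) : ℕ → TM2.Cfg Γ Λ σ → TM2.Cfg Γ Λ σ → Prop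
  | refl (a) : StepsIn m 0 a a
  | head {t a b c} : TM2.step m a = some b → StepsIn m t b c → StepsIn m (t + 1) a c

namespace StepsIn

open Turing

variable {K : Type} [DecidableEq K] {Γ : K → Type} {Λ σ : Type} {m : Λ → TM2.Stmt Γ Λ σ}

theorem trans {s t : ℕ} {a b c : TM2.Cfg Γ Λ σ} (h₁ : StepsIn m s a b) (h₂ : StepsIn m t b c) :
    StepsIn m (s + t) a c := by
  induction h₁ with
  | refl a => simpa using h₂
  | head h _ ih => rw [Nat.add_right_comm]; exact .head h (ih h₂)

/-- The relation in terms of the iteration by which Mathlib defines the runs of a machine. -/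
theorem iff_iterate {t : ℕ} {a b : TM2.Cfg Γ Λ σ} :
    StepsIn m t a b ↔ (flip bind (TM2.step m))^[t] (some a) = some b := by
  have hnone : ∀ t : ℕ, (flip bind (TM2.step m))^[t] none = none := by
    intro t
    induction t with
    | zero => rfl
    | succ t ih => rw [Function.iterate_succ_apply]; exact ih
  induction t generalizing a with
  | zero =>
    constructor
    · rintro ⟨⟩; rfl
    · intro h; cases h; exact .refl _
  | succ t ih =>
    rw [Function.iterate_succ_apply]
    have hs : flip bind (TM2.step m) (some a) = TM2.step m a := rfl
    rw [hs]
    constructor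
    · rintro (_ | ⟨h, h'⟩)
      rw [h]; exact ih.1 h'
    · intro h
      cases hb : TM2.step m a with
      | none => rw [hb, hnone] at h; cases h
      | some c => rw [hb] at h; exact .head hb (ih.2 h)

end StepsIn

/-- The statement `q` with its jumps redirected along `e`, and with halting replaced by a jump
to `x` (or kept, if `x = none`). -/
def Turing.TM2.Stmt.link {K : Type} {Γ : K → Type} {Λ L σ : Type} (e : Λ → L) (x : Option L) :
    Turing.TM2.Stmt Γ Λ σ → Turing.TM2.Stmt Γ L σ
  | .push k f q => .push k f (link e x q)
  | .peek k f q => .peek k f (link e x q)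
  | .pop k f q => .pop k f (link e x q)
  | .load f q => .load f (link e x q)
  | .branch f q₁ q₂ => .branch f (link e x q₁) (link e x q₂)
  | .goto f => .goto fun v => e (f v)
  | .halt => x.elim .halt fun l => .goto fun _ => l

/-- A piece of code for a stack machine: finitely many labels, one of them the entry;
halting means leaving the piece. -/
structure Frag (K : Type) (Γ : K → Type) (σ : Type) where
  /-- the labels -/
  Λ : Type
  /-- there are finitely many labels -/
  fin : Fintype Λ
  /-- the label at which the execution starts -/
  entry : Λ
  /-- the statement at each label -/
  code : Λ → Turing.TM2.Stmt Γ Λ σ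

namespace Frag

open Turing

variable {K : Type} [DecidableEq K] {Γ : K → Type} {σ : Type}

theorem stepAux_link {Λ L : Type} (e : Λ → L) (x : Option L) (q : TM2.Stmt Γ Λ σ) (v : σ)
    (S : ∀ k, List (Γ k)) :
    TM2.stepAux (q.link e x) v S =
      ⟨(TM2.stepAux q v S).l.elim x (fun l => some (e l)), (TM2.stepAux q v S).var,
        (TM2.stepAux q v S).stk⟩ := by
  induction q generalizing v S with
  | push k f q ih => simp [TM2.Stmt.link, ih]
  | peek k f q ih => simp [TM2.Stmt.link, ih]
  | pop k f q ih => simp [TM2.Stmt.link, ih]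
  | load f q ih => simp [TM2.Stmt.link, ih]
  | branch f q₁ q₂ ih₁ ih₂ =>
    simp only [TM2.Stmt.link, TM2.stepAux]
    cases f v <;> simp [ih₁, ih₂]
  | goto f => simp [TM2.Stmt.link]
  | halt => cases x <;> simp [TM2.Stmt.link]

/-- A run of a piece of code is also a run of any machine that contains the piece. -/
theorem stepsIn_link {Λ L : Type} {e : Λ → L} {x : Option L} {m : Λ → TM2.Stmt Γ Λ σ}
    {m' : L → TM2.Stmt Γ L σ} (h : ∀ l, m' (e l) = (m l).link e x) {t : ℕ} {a b : TM2.Cfg Γ Λ σ}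
    (hab : StepsIn m t a b) {l : Λ} (ha : a.l = some l) (hb : b.l = none) :
    StepsIn m' t ⟨some (e l), a.var, a.stk⟩ ⟨x, b.var, b.stk⟩ := by
  induction hab generalizing l with
  | refl a => rw [ha] at hb; cases hb
  | @head t a b c hs hbc ih =>
    obtain ⟨al, av, aS⟩ := a
    cases ha
    have hs' : TM2.stepAux (m l) av aS = b := by simpa using hs
    have h1 : TM2.step m' ⟨some (e l), av, aS⟩ =
        some ⟨b.l.elim x (fun l => some (e l)), b.var, b.stk⟩ := by
      rw [← hs']; simp [h, stepAux_link]
    refine .head h1 ?_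
    obtain ⟨bl, bv, bS⟩ := b
    cases bl with
    | none =>
      cases hbc with
      | refl => exact .refl _
      | head hn => simp at hn
    | some l' => exact ih rfl hb

/-- `F.Runs S S' t`: started at its entry with the stacks `S`, the piece `F` of code halts after at
most `t` steps with the stacks `S'`, whatever the initial internal state. -/
def Runs (F : Frag K Γ σ) (S S' : ∀ k, List (Γ k)) (t : ℕ) : Prop :=
  ∀ v, ∃ v', ∃ s ≤ t, StepsIn F.code s ⟨some F.entry, v, S⟩ ⟨none, v', S'⟩

theorem Runs.mono {F : Frag K Γ σ} {S S' : ∀ k, List (Γ k)} {t t' : ℕ} (h : F.Runs S S' t)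
    (ht : t ≤ t') : F.Runs S S' t' := fun v =>
  let ⟨v', s, hs, h'⟩ := h v
  ⟨v', s, hs.trans ht, h'⟩

/-- The piece with a single statement, which must not jump. -/
def single (q : TM2.Stmt Γ Unit σ) : Frag K Γ σ := ⟨Unit, inferInstance, (), fun _ => q⟩

theorem single_runs {q : TM2.Stmt Γ Unit σ} {S S' : ∀ k, List (Γ k)}
    (h : ∀ v, ∃ v', TM2.stepAux q v S = ⟨none, v', S'⟩) : (single q).Runs S S' 1 := fun v =>
  let ⟨v', hv⟩ := h v
  ⟨v', 1, le_rfl, .head (by simp [single, hv]) (.refl _)⟩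

/-- The piece that does nothing. -/
def skip : Frag K Γ σ := single .halt

theorem skip_runs (S : ∀ k, List (Γ k)) : (skip : Frag K Γ σ).Runs S S 1 :=
  single_runs fun v => ⟨v, by simp⟩

/-- The piece that pushes `a` on the stack `k`. -/
def push (k : K) (a : Γ k) : Frag K Γ σ := single (.push k (fun _ => a) .halt)

theorem push_runs (k : K) (a : Γ k) (S : ∀ k, List (Γ k)) :
    (push k a : Frag K Γ σ).Runs S (Function.update S k (a :: S k)) 1 :=
  single_runs fun v => ⟨v, by simp⟩

/-- The composition of two pieces of code. -/
def seq (F G : Frag K Γ σ) : Frag K Γ σ where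
  Λ := F.Λ ⊕ G.Λ
  fin := letI := F.fin; letI := G.fin; inferInstance
  entry := .inl F.entry
  code := Sum.elim (fun l => (F.code l).link .inl (some (.inr G.entry)))
    (fun l => (G.code l).link .inr none)

theorem Runs.seq {F G : Frag K Γ σ} {S S' S'' : ∀ k, List (Γ k)} {t t' : ℕ} (hF : F.Runs S S' t)
    (hG : G.Runs S' S'' t') : (F.seq G).Runs S S'' (t + t') := by
  intro v
  obtain ⟨v', s, hs, h⟩ := hF v
  obtain ⟨v'', s', hs', h'⟩ := hG v'
  refine ⟨v'', s + s', by omega, ?_⟩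
  exact (stepsIn_link (m' := (F.seq G).code) (fun _ => rfl) h rfl rfl).trans
    (stepsIn_link (m' := (F.seq G).code) (fun _ => rfl) h' rfl rfl)

/-- The loop "pop the stack `k`; if a symbol satisfying `p` was popped, then execute `F` and
repeat". The flag in the internal state holds the outcome of the test. -/
def loopWhile (k : K) (p : Γ k → Bool) (F : Frag K Γ (Bool × σ)) : Frag K Γ (Bool × σ) where
  Λ := Option F.Λ
  fin := letI := F.fin; inferInstance
  entry := none
  code l := l.elim
    (.pop k (fun v o => (o.any p, v.2)) (.branch (fun v => v.1) (.goto fun _ => some F.entry) .halt))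
    (fun l => (F.code l).link some (some none))

theorem loopWhile_nil {k : K} (p : Γ k → Bool) (F : Frag K Γ (Bool × σ)) {S : ∀ k, List (Γ k)}
    (h : S k = []) : (loopWhile k p F).Runs S S 1 := fun v =>
  ⟨(false, v.2), 1, le_rfl, .head (by
    have : Function.update S k [] = S := by rw [← h]; simp
    simp [loopWhile, h, this]) (.refl _)⟩

theorem loopWhile_stop {k : K} {p : Γ k → Bool} (F : Frag K Γ (Bool × σ)) {S : ∀ k, List (Γ k)}
    {a : Γ k} {l : List (Γ k)} (h : S k = a :: l) (ha : p a = false) :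
    (loopWhile k p F).Runs S (Function.update S k l) 1 := fun v =>
  ⟨(false, v.2), 1, le_rfl, .head (by simp [loopWhile, h, ha]) (.refl _)⟩

theorem loopWhile_cons {k : K} {p : Γ k → Bool} {F : Frag K Γ (Bool × σ)}
    {S S' S'' : ∀ k, List (Γ k)} {a : Γ k} {l : List (Γ k)} {t t' : ℕ} (h : S k = a :: l)
    (ha : p a = true) (hF : F.Runs (Function.update S k l) S' t)
    (hL : (loopWhile k p F).Runs S' S'' t') : (loopWhile k p F).Runs S S'' (t + t' + 1) := by
  intro v
  obtain ⟨v', s, hs, h₁⟩ := hF (true, v.2)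
  obtain ⟨v'', s', hs', h₂⟩ := hL v'
  refine ⟨v'', s + s' + 1, by omega, .head (b := ⟨some (some F.entry), (true, v.2), _⟩) ?_
    ((stepsIn_link (m' := (loopWhile k p F).code) (fun _ => rfl) h₁ rfl rfl).trans h₂)⟩
  simp [loopWhile, h, ha]

/-- A loop whose `i`-th round leads from the stacks `S i` to the stacks `S (i + 1)`. -/
theorem loopWhile_runs {k : K} {p : Γ k → Bool} {F : Frag K Γ (Bool × σ)} {t t' N : ℕ}
    {S : ℕ → ∀ k, List (Γ k)} {S' : ∀ k, List (Γ k)}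
    (hS : ∀ i < N, ∃ a l, S i k = a :: l ∧ p a = true ∧
      F.Runs (Function.update (S i) k l) (S (i + 1)) t)
    (hN : (loopWhile k p F).Runs (S N) S' t') :
    (loopWhile k p F).Runs (S 0) S' (N * (t + 1) + t') := by
  induction N generalizing S with
  | zero => simpa using hN
  | succ N ih =>
    obtain ⟨a, l, h, ha, hF⟩ := hS 0 (Nat.succ_pos _)
    refine (loopWhile_cons h ha hF (ih (S := fun i => S (i + 1)) (fun i hi => ?_) hN)).mono ?_
    · exact hS (i + 1) (by omega)
    · rw [Nat.succ_mul]; omega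

end Frag

/-! ### Counter programs -/

/-- The alphabets of a machine with counters indexed by `R` and further stacks indexed by `X`:
a counter is a stack over a one-letter alphabet. -/
abbrev RegAlphabet {X : Type} (R : Type) (A : X → Type) : R ⊕ X → Type
  | .inl _ => Unit
  | .inr i => A i

/-- The stacks with counter values `c` and contents `x` of the further stacks. -/
def regState {R X : Type} {A : X → Type} (c : R → ℕ) (x : ∀ i, List (A i)) :
    ∀ k, List (RegAlphabet R A k)
  | .inl r => List.replicate (c r) ()
  | .inr i => x i

/-- A piece of code for a machine with counters; the Boolean flag is used by loops. -/
abbrev RegFrag (R : Type) {X : Type} (A : X → Type) (σ : Type) : Type 1 :=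
  Frag (R ⊕ X) (RegAlphabet R A) (Bool × σ)

namespace RegFrag

variable {R X : Type} [DecidableEq R] [DecidableEq X] {A : X → Type} {σ : Type}

theorem update_regState_inl (c : R → ℕ) (x : ∀ i, List (A i)) (r : R) (n : ℕ) :
    Function.update (regState c x) (.inl r) (List.replicate n ()) =
      regState (Function.update c r n) x := by
  funext k
  rcases k with s | i
  · by_cases h : s = r
    · subst h
      rw [Function.update_self, regState, Function.update_self]
    · rw [Function.update_of_ne (by simpa using h)]
      simp [regState, Function.update_of_ne h]
  · rw [Function.update_of_ne (by simp)]
    rfl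

theorem update_regState_inr (c : R → ℕ) (x : ∀ i, List (A i)) (i : X) (l : List (A i)) :
    Function.update (regState c x) (.inr i) l = regState c (Function.update x i l) := by
  funext k
  rcases k with s | j
  · rw [Function.update_of_ne (by simp)]
    rfl
  · by_cases h : j = i
    · subst h
      rw [Function.update_self, regState, Function.update_self]
    · rw [Function.update_of_ne (by simpa using h)]
      simp [regState, Function.update_of_ne h]

/-- Add one to the counter `r`. -/
def inc (r : R) : RegFrag R A σ :=
  Frag.push (Γ := RegAlphabet R A) (.inl r) ()

theorem inc_runs (r : R) (c : R → ℕ) (x : ∀ i, List (A i)) :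
    (inc r : RegFrag R A σ).Runs (regState c x)
      (regState (Function.update c r (c r + 1)) x) 1 := by
  rw [← update_regState_inl]
  exact Frag.push_runs (Γ := RegAlphabet R A) (.inl r) () _

/-- Push `a` on the further stack `i`. -/
def emit (i : X) (a : A i) : RegFrag R A σ :=
  Frag.push (Γ := RegAlphabet R A) (.inr i) a

theorem emit_runs (i : X) (a : A i) (c : R → ℕ) (x : ∀ i, List (A i)) :
    (emit i a : RegFrag R A σ).Runs (regState c x)
      (regState c (Function.update x i (a :: x i))) 1 := by
  rw [← update_regState_inr]
  exact Frag.push_runs (Γ := RegAlphabet R A) (.inr i) a _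

/-- While the counter `r` is positive, decrease it and execute `F`. -/
def loop (r : R) (F : RegFrag R A σ) : RegFrag R A σ :=
  Frag.loopWhile (.inl r) (fun _ => true) F

/-- A loop whose `i`-th round leads from the counters `c i` and the stacks `x i` to the next ones;
the counter `r` holds the number of rounds that remain. -/
theorem loop_runs {r : R} {F : RegFrag R A σ} {t N : ℕ} {c : ℕ → R → ℕ}
    {x : ℕ → ∀ i, List (A i)} (hc : ∀ i ≤ N, c i r = N - i)
    (hF : ∀ i < N, F.Runs (regState (Function.update (c i) r (N - (i + 1))) (x i))
      (regState (c (i + 1)) (x (i + 1))) t) :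
    (loop r F).Runs (regState (c 0) (x 0)) (regState (c N) (x N)) (N * (t + 1) + 1) := by
  refine Frag.loopWhile_runs (S := fun i => regState (c i) (x i)) (fun i hi => ?_) ?_
  · refine ⟨(), List.replicate (N - (i + 1)) (), ?_, rfl, ?_⟩
    · show List.replicate (c i r) () = _
      rw [hc i hi.le, show N - i = N - (i + 1) + 1 by omega]; rfl
    · rw [update_regState_inl]; exact hF i hi
  · apply Frag.loopWhile_nil
    show List.replicate (c N r) () = _
    rw [hc N le_rfl, Nat.sub_self]; rfl

/-- The case of a loop that does not touch the further stacks. -/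
theorem loop_runs_frame {r : R} {F : RegFrag R A σ} {t N : ℕ} {c : ℕ → R → ℕ}
    {x : ∀ i, List (A i)} (hc : ∀ i ≤ N, c i r = N - i)
    (hF : ∀ i < N, F.Runs (regState (Function.update (c i) r (N - (i + 1))) x)
      (regState (c (i + 1)) x) t) :
    (loop r F).Runs (regState (c 0) x) (regState (c N) x) (N * (t + 1) + 1) :=
  loop_runs (x := fun _ => x) hc hF

/-- Set the counter `r` to zero. -/
def clear (r : R) : RegFrag R A σ := loop r Frag.skip

theorem clear_runs (r : R) (c : R → ℕ) (x : ∀ i, List (A i)) :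
    (clear r : RegFrag R A σ).Runs (regState c x) (regState (Function.update c r 0) x)
      (c r * 2 + 1) := by
  have := loop_runs_frame (σ := σ) (r := r) (F := Frag.skip) (t := 1) (N := c r) (x := x)
    (c := fun i => Function.update c r (c r - i)) (fun i _ => by simp) (fun i hi => by
      simpa using Frag.skip_runs _)
  simpa [clear] using this

/-- Move the contents of the counter `r` to the counter `s`. -/
def move (r s : R) : RegFrag R A σ := loop r (inc s)

theorem move_runs {r s : R} (h : r ≠ s) (c : R → ℕ) (x : ∀ i, List (A i)) :
    (move r s : RegFrag R A σ).Runs (regState c x)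
      (regState (Function.update (Function.update c s (c s + c r)) r 0) x) (c r * 2 + 1) := by
  have := loop_runs_frame (σ := σ) (r := r) (F := inc s) (t := 1) (N := c r) (x := x)
    (c := fun i => Function.update (Function.update c s (c s + i)) r (c r - i))
    (fun i _ => by simp) (fun i hi => by
      convert inc_runs s _ x using 2
      funext k
      by_cases h1 : k = r
      · subst h1; simp [h]
      · by_cases h2 : k = s
        · subst h2; simp [h.symm, add_assoc]
        · simp [h1, h2])
  simpa [move] using this

/-- Add the contents of the counter `r` to the counter `s`, using the empty counter `u`. -/
def copy (r s u : R) : RegFrag R A σ := (loop r ((inc s).seq (inc u))).seq (move u r)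

theorem copy_runs {r s u : R} (hrs : r ≠ s) (hru : r ≠ u) (hsu : s ≠ u) (c : R → ℕ)
    (hu : c u = 0) (x : ∀ i, List (A i)) :
    (copy r s u : RegFrag R A σ).Runs (regState c x)
      (regState (Function.update c s (c s + c r)) x) (c r * 5 + 2) := by
  have h1 := loop_runs_frame (σ := σ) (r := r) (F := (inc s).seq (inc u)) (t := 2) (N := c r)
    (x := x)
    (c := fun i => Function.update (Function.update (Function.update c s (c s + i)) u i)
      r (c r - i))
    (fun i _ => by simp) (fun i hi => by
      convert (inc_runs s _ x).seq (inc_runs u _ x) using 2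
      funext k
      by_cases h1 : k = r
      · subst h1; simp [hrs, hru]
      · by_cases h2 : k = s
        · subst h2; simp [hrs.symm, hsu, add_assoc]
        · by_cases h3 : k = u
          · subst h3; simp [h1, h2]
          · simp [h1, h2, h3])
  have h2 := move_runs (σ := σ) hru.symm (Function.update (Function.update (Function.update c s
    (c s + c r)) u (c r)) r (c r - c r)) x
  have h0 : Function.update (Function.update (Function.update c s (c s + 0)) u 0) r (c r - 0) =
      c := by
    rw [Nat.add_zero, Nat.sub_zero, Function.update_eq_self, ← hu, Function.update_eq_self,
      Function.update_eq_self]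
  simp only [h0] at h1
  refine Frag.Runs.mono (Frag.Runs.seq h1 (S'' := regState (Function.update c s (c s + c r)) x)
    (t' := c r * 2 + 1) ?_) ?_
  · convert h2 using 2
    · funext k
      by_cases h1 : k = u
      · subst h1; simp [hsu.symm, hu]
      · by_cases h2 : k = s
        · subst h2; simp [hrs.symm, hsu]
        · by_cases h3 : k = r
          · subst h3; simp [hrs, hru, hru.symm]
          · simp [h1, h2, h3]
    · simp [hru.symm]
  · omega

end RegFrag

open Polynomial in
/-- The function `f` is bounded by a polynomial in the sum of its arguments. -/
def PolyBdd {k : ℕ} (f : (Fin k → ℕ) → ℕ) : Prop :=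
  ∃ p : ℕ[X], ∀ v, f v ≤ p.eval (∑ i, v i)

open Polynomial in
/-- The function `f` of `k` variables is computed by a counter program in polynomial time: on
every machine with sufficiently many counters, a piece of code adds `f` of the argument counters
to the output counter. The scratch counters `scr 0, …, scr (s - 1)` have to be zero at the start,
and are zero at the end. -/
def CounterPoly {k : ℕ} (f : (Fin k → ℕ) → ℕ) : Prop :=
  PolyBdd f ∧ ∃ (s : ℕ) (p : ℕ[X]), ∀ (R X : Type) [DecidableEq R] [DecidableEq X] (A : X → Type)
    (σ : Type) (args : Fin k → R) (out : R) (scr : ℕ → R), (∀ i, args i ≠ out) →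
    (∀ i, ∀ j < s, args i ≠ scr j) → (∀ j < s, out ≠ scr j) →
    (∀ i < s, ∀ j < s, scr i = scr j → i = j) →
    ∃ F : RegFrag R A σ, ∀ (c : R → ℕ) (x : ∀ i, List (A i)), (∀ j < s, c (scr j) = 0) →
      F.Runs (regState c x)
        (regState (Function.update c out (c out + f fun i => c (args i))) x)
        (p.eval (∑ i, c (args i)))

open Polynomial in
theorem Polynomial.eval_mono_nat (p : ℕ[X]) {a b : ℕ} (h : a ≤ b) : p.eval a ≤ p.eval b := by
  rw [eval_eq_sum, eval_eq_sum]
  exact Finset.sum_le_sum fun i _ => Nat.mul_le_mul_left _ (Nat.pow_le_pow_left h i)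

namespace PolyBdd

open Polynomial

variable {k : ℕ} {f g : (Fin k → ℕ) → ℕ}

theorem const (n : ℕ) : PolyBdd fun _ : Fin k → ℕ => n := ⟨C n, fun v => by simp⟩

theorem proj (i : Fin k) : PolyBdd fun v => v i :=
  ⟨X, fun v => by simpa using Finset.single_le_sum (f := v) (by simp) (Finset.mem_univ i)⟩

theorem add (hf : PolyBdd f) (hg : PolyBdd g) : PolyBdd fun v => f v + g v :=
  let ⟨p, hp⟩ := hf
  let ⟨q, hq⟩ := hg
  ⟨p + q, fun v => by simpa using Nat.add_le_add (hp v) (hq v)⟩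

theorem mul (hf : PolyBdd f) (hg : PolyBdd g) : PolyBdd fun v => f v * g v :=
  let ⟨p, hp⟩ := hf
  let ⟨q, hq⟩ := hg
  ⟨p * q, fun v => by simpa using Nat.mul_le_mul (hp v) (hq v)⟩

end PolyBdd

theorem sum_comp_le {k l : ℕ} (v : Fin l → ℕ) (ρ : Fin k → Fin l) :
    ∑ i, v (ρ i) ≤ k * ∑ i, v i := by
  calc ∑ i, v (ρ i) ≤ ∑ _i : Fin k, ∑ i, v i :=
        Finset.sum_le_sum fun i _ => Finset.single_le_sum (f := v) (by simp) (Finset.mem_univ _)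
    _ = k * ∑ i, v i := by simp

namespace CounterPoly

open Polynomial RegFrag

variable {k : ℕ}

theorem zero : CounterPoly fun _ : Fin k → ℕ => 0 :=
  ⟨.const 0, 0, 1, fun R X _ _ A σ args out scr _ _ _ _ => ⟨Frag.skip, fun c x _ => by
    simpa using Frag.skip_runs _⟩⟩

theorem one : CounterPoly fun _ : Fin k → ℕ => 1 :=
  ⟨.const 1, 0, 1, fun R X _ _ A σ args out scr _ _ _ _ => ⟨inc out, fun c x _ => by
    simpa using inc_runs out c x⟩⟩

theorem proj (i : Fin k) : CounterPoly fun v => v i :=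
  ⟨.proj i, 1, X * 5 + 2, fun R X _ _ A σ args out scr h1 h2 h3 _ =>
    ⟨copy (args i) out (scr 0), fun c x h0 =>
      (copy_runs (h1 i) (h2 i 0 one_pos) (h3 0 one_pos) c (h0 0 one_pos) x).mono (by
        have := Finset.single_le_sum (f := fun i => c (args i)) (by simp) (Finset.mem_univ i)
        simp only [eval_add, eval_mul, eval_X, eval_ofNat]
        omega)⟩⟩

theorem add {f g : (Fin k → ℕ) → ℕ} (hf : CounterPoly f) (hg : CounterPoly g) :
    CounterPoly fun v => f v + g v := by
  obtain ⟨bf, s, p, hf⟩ := hf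
  obtain ⟨bg, s', p', hg⟩ := hg
  refine ⟨bf.add bg, max s s', p + p', fun R X _ _ A σ args out scr h1 h2 h3 h4 => ?_⟩
  obtain ⟨F, hF⟩ := hf R X A σ args out scr h1 (fun i j hj => h2 i j (by omega))
    (fun j hj => h3 j (by omega)) (fun i hi j hj => h4 i (by omega) j (by omega))
  obtain ⟨G, hG⟩ := hg R X A σ args out scr h1 (fun i j hj => h2 i j (by omega))
    (fun j hj => h3 j (by omega)) (fun i hi j hj => h4 i (by omega) j (by omega))
  refine ⟨F.seq G, fun c x h0 => ?_⟩
  have r1 := hF c x (fun j hj => h0 j (by omega))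
  have r2 := hG (Function.update c out (c out + f fun i => c (args i))) x (fun j hj => by
    rw [Function.update_of_ne (h3 j (by omega)).symm]; exact h0 j (by omega))
  simp only [Function.update_self, Function.update_idem, Function.update_of_ne (h1 _)] at r2
  simpa [add_assoc] using r1.seq r2

theorem rename {l : ℕ} {f : (Fin k → ℕ) → ℕ} (hf : CounterPoly f) (ρ : Fin k → Fin l) :
    CounterPoly fun v : Fin l → ℕ => f fun i => v (ρ i) := by
  obtain ⟨⟨q, hq⟩, s, p, hf⟩ := hf
  refine ⟨⟨q.comp (C k * X), fun v => (hq _).trans ?_⟩, s, p.comp (C k * X),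
    fun R X _ _ A σ args out scr h1 h2 h3 h4 => ?_⟩
  · simpa using q.eval_mono_nat (sum_comp_le v ρ)
  · obtain ⟨F, hF⟩ := hf R X A σ (args ∘ ρ) out scr (fun i => h1 _) (fun i => h2 _) h3 h4
    refine ⟨F, fun c x h0 => (hF c x h0).mono ?_⟩
    simpa using p.eval_mono_nat (sum_comp_le (fun i => c (args i)) ρ)

/-- Substitution of a computable value for the first variable. -/
theorem bind {g : (Fin k → ℕ) → ℕ} {h : (Fin (k + 1) → ℕ) → ℕ} (hh : CounterPoly h)
    (hg : CounterPoly g) : CounterPoly fun v => h (Fin.cons (g v) v) := by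
  obtain ⟨⟨qh, bh⟩, s, p, hh⟩ := hh
  obtain ⟨⟨qg, bg⟩, s', p', hg⟩ := hg
  refine ⟨⟨qh.comp (qg + X), fun v => (bh _).trans ?_⟩, max s s' + 1,
    p' + p.comp (qg + X) + (qg * 2 + 1), fun R X _ _ A σ args out scr h1 h2 h3 h4 => ?_⟩
  · rw [Fin.sum_univ_succ]
    simpa using qh.eval_mono_nat (Nat.add_le_add_right (bg v) _)
  have ne0 : ∀ j < max s s', scr (j + 1) ≠ scr 0 := fun j hj h => by
    have := h4 _ (by omega) _ (by omega) h
    omega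
  obtain ⟨G, hG⟩ := hg R X A σ args (scr 0) (fun j => scr (j + 1)) (fun i => h2 i 0 (by omega))
    (fun i j hj => h2 i _ (by omega)) (fun j hj => (ne0 j (by omega)).symm)
    (fun i hi j hj h => by have := h4 _ (by omega) _ (by omega) h; omega)
  obtain ⟨H, hH⟩ := hh R X A σ (Fin.cons (scr 0) args) out (fun j => scr (j + 1))
    (Fin.cases (h3 0 (by omega)).symm h1)
    (Fin.cases (fun j hj => by simpa using (ne0 j (by omega)).symm)
      (fun i j hj => h2 i _ (by omega)))
    (fun j hj => h3 _ (by omega))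
    (fun i hi j hj h => by have := h4 _ (by omega) _ (by omega) h; omega)
  refine ⟨(G.seq H).seq (clear (scr 0)), fun c x h0 => ?_⟩
  have r1 := hG c x (fun j hj => h0 _ (by omega))
  have c0 := h0 0 (by omega)
  have ho := h3 0 (by omega)
  set c1 := Function.update c (scr 0) (c (scr 0) + g fun i => c (args i)) with hc1
  have r2 := hH c1 x (fun j hj => by
    rw [hc1, Function.update_of_ne (ne0 j (by omega))]; exact h0 _ (by omega))
  have harg : (fun i => c1 ((Fin.cons (scr 0) args : Fin (k + 1) → R) i)) =
      Fin.cons (g fun i => c (args i)) (fun i => c (args i)) := by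
    funext i
    refine Fin.cases ?_ (fun i => ?_) i
    · simp [hc1, c0]
    · simp [hc1, Function.update_of_ne (h2 i 0 (by omega))]
  rw [harg, Fin.sum_cons] at r2
  set c2 := Function.update c1 out (c1 out + h (Fin.cons (g fun i => c (args i))
    (fun i => c (args i)))) with hc2
  have r3 := clear_runs (σ := σ) (scr 0) c2 x
  have e2 : c2 (scr 0) = g fun i => c (args i) := by
    rw [hc2, Function.update_of_ne ho.symm, hc1, Function.update_self, c0, zero_add]
  rw [e2] at r3
  have e3 : Function.update c2 (scr 0) 0 = Function.update c out (c out +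
      h (Fin.cons (g fun i => c (args i)) (fun i => c (args i)))) := by
    funext r
    by_cases hr : r = scr 0
    · subst hr; simp [ho.symm, c0]
    · by_cases hr' : r = out
      · subst hr'; simp [hc2, hc1, ho]
      · simp [hc2, hc1, hr, hr']
  rw [e3] at r3
  refine ((r1.seq r2).seq r3).mono ?_
  simp only [eval_add, eval_comp, eval_mul, eval_X, eval_ofNat, eval_one]
  have := bg fun i => c (args i)
  have := p.eval_mono_nat (Nat.add_le_add_right (bg fun i => c (args i)) (∑ i, c (args i)))
  omega

/-- Primitive recursion, provided that all intermediate values are polynomially bounded. -/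
theorem prec {g n B : (Fin k → ℕ) → ℕ} {h : (Fin k → ℕ) → ℕ → ℕ → ℕ} (hg : CounterPoly g)
    (hh : CounterPoly fun u : Fin (k + 2) → ℕ => h (fun i => u i.succ.succ) (u 0) (u 1))
    (hn : CounterPoly n) (hB : PolyBdd B)
    (hb : ∀ v, ∀ i ≤ n v, Nat.rec (motive := fun _ => ℕ) (g v) (h v) i ≤ B v) :
    CounterPoly fun v => Nat.rec (motive := fun _ => ℕ) (g v) (h v) (n v) := by
  obtain ⟨qB, bB⟩ := hB
  obtain ⟨_, sg, pg, hg⟩ := hg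
  obtain ⟨_, sh, ph, hh⟩ := hh
  obtain ⟨⟨qn, bn⟩, sn, pn, hn⟩ := hn
  refine ⟨⟨qB, fun v => (hb v _ le_rfl).trans (bB v)⟩, max sg (max sh sn) + 4,
    pn + pg + (qn * (ph.comp (qn + qB + X) + (qB * 2 + 1) + (qB * 2 + 1) + 1 + 1) + 1) +
      (qB * 2 + 1) + (qn * 2 + 1),
    fun R X _ _ A σ args out scr h1 h2 h3 h4 => ?_⟩
  set s := max sg (max sh sn) with hs
  have inj : ∀ i < s + 4, ∀ j < s + 4, i ≠ j → scr i ≠ scr j :=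
    fun i hi j hj hij h => hij (h4 i hi j hj h)
  have injs : ∀ t ≤ s, ∀ i < t, ∀ j < t, scr (i + 4) = scr (j + 4) → i = j :=
    fun t ht i hi j hj h => by have := h4 _ (by omega) _ (by omega) h; omega
  obtain ⟨N, hN⟩ := hn R X A σ args (scr 0) (fun j => scr (j + 4)) (fun i => h2 i 0 (by omega))
    (fun i j hj => h2 i _ (by omega)) (fun j hj => inj _ (by omega) _ (by omega) (by omega))
    (injs _ (by omega))
  obtain ⟨G, hG⟩ := hg R X A σ args (scr 2) (fun j => scr (j + 4)) (fun i => h2 i 2 (by omega))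
    (fun i j hj => h2 i _ (by omega)) (fun j hj => inj _ (by omega) _ (by omega) (by omega))
    (injs _ (by omega))
  obtain ⟨H, hH⟩ := hh R X A σ (Fin.cons (scr 1) (Fin.cons (scr 2) args)) (scr 3)
    (fun j => scr (j + 4))
    (Fin.cases (inj _ (by omega) _ (by omega) (by omega))
      (Fin.cases (inj _ (by omega) _ (by omega) (by omega)) (fun i => h2 i _ (by omega))))
    (Fin.cases (fun j hj => inj _ (by omega) _ (by omega) (by omega))
      (Fin.cases (fun j hj => inj _ (by omega) _ (by omega) (by omega))
        (fun i j hj => h2 i _ (by omega))))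
    (fun j hj => inj _ (by omega) _ (by omega) (by omega))
    (injs _ (by omega))
  refine ⟨(((N.seq G).seq (loop (scr 0) (((H.seq (clear (scr 2))).seq
    (move (scr 3) (scr 2))).seq (inc (scr 1))))).seq (move (scr 2) out)).seq (clear (scr 1)),
    fun c x h0 => ?_⟩
  have n01 := inj 0 (by omega) 1 (by omega) (by omega)
  have n02 := inj 0 (by omega) 2 (by omega) (by omega)
  have n03 := inj 0 (by omega) 3 (by omega) (by omega)
  have n12 := inj 1 (by omega) 2 (by omega) (by omega)
  have n13 := inj 1 (by omega) 3 (by omega) (by omega)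
  have n23 := inj 2 (by omega) 3 (by omega) (by omega)
  have z0 := h0 0 (by omega)
  have z1 := h0 1 (by omega)
  have z2 := h0 2 (by omega)
  have z3 := h0 3 (by omega)
  have o1 := h3 1 (by omega)
  have o2 := h3 2 (by omega)
  have o0 := h3 0 (by omega)
  set v : Fin k → ℕ := fun i => c (args i) with hv
  -- the counters before round `j` of the main loop
  let acc : ℕ → ℕ := fun j => Nat.rec (motive := fun _ => ℕ) (g v) (h v) j
  let st : ℕ → R → ℕ := fun j => Function.update (Function.update (Function.update c (scr 2)
    (acc j)) (scr 1) j) (scr 0) (n v - j)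
  have sv : ∀ j m, (fun i => Function.update (st j) (scr 0) m (args i)) = v := fun j m => by
    funext i
    simp [st, hv, h2 i 0 (by omega), h2 i 1 (by omega), h2 i 2 (by omega)]
  have r1 := hN c x (fun j hj => h0 _ (by omega))
  rw [z0, zero_add] at r1
  have r2 := hG (Function.update c (scr 0) (n v)) x (fun j hj => by
    rw [Function.update_of_ne (inj _ (by omega) _ (by omega) (by omega))]; exact h0 _ (by omega))
  have e2 : (fun i => Function.update c (scr 0) (n v) (args i)) = v := by
    funext i
    rw [Function.update_of_ne (h2 i 0 (by omega))]
  have e2' : Function.update (Function.update c (scr 0) (n v)) (scr 2)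
      (Function.update c (scr 0) (n v) (scr 2) + g v) = st 0 := by
    funext r
    by_cases hr2 : r = scr 2
    · subst hr2; simp [st, n02.symm, n12.symm, z2, acc]
    · by_cases hr1 : r = scr 1
      · subst hr1; simp [st, n01.symm, n12, z1]
      · by_cases hr0 : r = scr 0
        · subst hr0; simp [st, n02]
        · simp [st, hr0, hr1, hr2]
  rw [e2, e2'] at r2
  have bacc : ∀ j ≤ n v, acc j ≤ qB.eval (∑ i, v i) := fun j hj => (hb v j hj).trans (bB v)
  have r3 := loop_runs_frame (σ := σ) (r := scr 0) (F := ((H.seq (clear (scr 2))).seq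
    (move (scr 3) (scr 2))).seq (inc (scr 1))) (N := n v) (c := st) (x := x)
    (t := (ph.comp (qn + qB + Polynomial.X)).eval (∑ i, v i) + (qB.eval (∑ i, v i) * 2 + 1) +
      (qB.eval (∑ i, v i) * 2 + 1) + 1) (fun j _ => by simp [st]) (fun j hj => by
      set d := Function.update (st j) (scr 0) (n v - (j + 1)) with hd
      have d1 : d (scr 1) = j := by simp [hd, st, n01.symm]
      have d2 : d (scr 2) = acc j := by simp [hd, st, n02.symm, n12.symm]
      have d3 : d (scr 3) = 0 := by simp [hd, st, n03.symm, n13.symm, n23.symm, z3]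
      have harg : (fun i => d ((Fin.cons (scr 1) (Fin.cons (scr 2) args) : Fin (k + 2) → R) i)) =
          Fin.cons j (Fin.cons (acc j) v) := by
        funext i
        refine Fin.cases ?_ (Fin.cases ?_ (fun i => ?_)) i
        · simpa using d1
        · simpa using d2
        · simpa using congrFun (sv j (n v - (j + 1))) i
      have q1 := hH d x (fun i hi => by
        simp only [hd, st]
        rw [Function.update_of_ne (inj _ (by omega) _ (by omega) (by omega)),
          Function.update_of_ne (inj _ (by omega) _ (by omega) (by omega)),
          Function.update_of_ne (inj _ (by omega) _ (by omega) (by omega)),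
          Function.update_of_ne (inj _ (by omega) _ (by omega) (by omega))]
        exact h0 _ (by omega))
      rw [harg, Fin.sum_cons, Fin.sum_cons, d3, zero_add] at q1
      have hval : h (fun i => (Fin.cons j (Fin.cons (acc j) v) : Fin (k + 2) → ℕ) i.succ.succ)
          ((Fin.cons j (Fin.cons (acc j) v) : Fin (k + 2) → ℕ) 0)
          ((Fin.cons j (Fin.cons (acc j) v) : Fin (k + 2) → ℕ) 1) = acc (j + 1) := rfl
      beta_reduce at q1
      rw [hval] at q1
      set d' := Function.update d (scr 3) (acc (j + 1)) with hd'
      have q2 := clear_runs (σ := σ) (scr 2) d' x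
      have d2' : d' (scr 2) = acc j := by rw [hd', Function.update_of_ne n23, d2]
      rw [d2'] at q2
      set d'' := Function.update d' (scr 2) 0 with hd''
      have q3 := move_runs (σ := σ) n23.symm d'' x
      have d2'' : d'' (scr 2) = 0 := by simp [hd'']
      have d3'' : d'' (scr 3) = acc (j + 1) := by simp [hd'', hd', n23.symm]
      rw [d2'', d3'', zero_add] at q3
      have q4 := inc_runs (σ := σ) (scr 1) (Function.update (Function.update d'' (scr 2)
        (acc (j + 1))) (scr 3) 0) x
      have fin : Function.update (Function.update (Function.update d'' (scr 2)
          (acc (j + 1))) (scr 3) 0) (scr 1) (Function.update (Function.update d'' (scr 2)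
          (acc (j + 1))) (scr 3) 0 (scr 1) + 1) = st (j + 1) := by
        have hd1 : Function.update (Function.update d'' (scr 2) (acc (j + 1))) (scr 3) 0 (scr 1) =
            j := by simp [hd'', hd', n13, n12, d1]
        rw [hd1]
        funext r
        by_cases hr1 : r = scr 1
        · subst hr1; simp [st, n01.symm]
        · by_cases hr3 : r = scr 3
          · subst hr3; simp [st, n03.symm, n13.symm, n23.symm, z3]
          · by_cases hr2 : r = scr 2
            · subst hr2; simp [st, n02.symm, n12.symm, n23]
            · by_cases hr0 : r = scr 0
              · subst hr0; simp [hd'', hd', hd, st, n01, n02, n03]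
              · simp [hd'', hd', hd, st, hr0, hr1, hr2, hr3]
      rw [fin] at q4
      refine (((q1.seq q2).seq q3).seq q4).mono ?_
      have b1 := bacc j hj.le
      have b2 := bacc (j + 1) hj
      have b3 := bn v
      have b4 := ph.eval_mono_nat (show j + (acc j + ∑ i, v i) ≤
        qn.eval (∑ i, v i) + qB.eval (∑ i, v i) + ∑ i, v i by omega)
      simp only [eval_comp, eval_add, eval_X]
      omega)
  have r4 := move_runs (σ := σ) o2.symm (st (n v)) x
  have f2 : st (n v) (scr 2) = acc (n v) := by simp [st, n02.symm, n12.symm]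
  have fo : st (n v) out = c out := by simp [st, o0, o1, o2]
  rw [f2, fo] at r4
  have r5 := clear_runs (σ := σ) (scr 1) (Function.update (Function.update (st (n v)) out
    (c out + acc (n v))) (scr 2) 0) x
  have f1 : Function.update (Function.update (st (n v)) out (c out + acc (n v))) (scr 2) 0
      (scr 1) = n v := by simp [st, n12, o1.symm, n01.symm]
  have fin : Function.update (Function.update (Function.update (st (n v)) out
      (c out + acc (n v))) (scr 2) 0) (scr 1) 0 = Function.update c out (c out + acc (n v)) := by
    funext r
    by_cases hr1 : r = scr 1
    · subst hr1; simp [o1.symm, z1]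
    · by_cases hr2 : r = scr 2
      · subst hr2; simp [hr1, o2.symm, z2]
      · by_cases hro : r = out
        · subst hro; simp [o1, o2]
        · by_cases hr0 : r = scr 0
          · subst hr0; simp [st, n01, n02, o0.symm, z0]
          · simp [st, hr0, hr1, hr2, hro]
  rw [f1, fin] at r5
  refine ((((r1.seq r2).seq r3).seq r4).seq r5).mono ?_
  have b1 := bacc (n v) le_rfl
  have b3 : n v ≤ qn.eval (∑ i, v i) := bn v
  have b4 := Nat.mul_le_mul_right ((ph.comp (qn + qB + Polynomial.X)).eval (∑ i, v i) +
    (qB.eval (∑ i, v i) * 2 + 1) + (qB.eval (∑ i, v i) * 2 + 1) + 1 + 1) b3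
  revert b1 b3 b4
  change _ → _ → _ → eval (∑ i, v i) pn + _ + _ + _ + _ ≤ _
  generalize ∑ i, v i = T
  intro b1 b3 b4
  simp only [eval_add, eval_mul, eval_ofNat, eval_one] at b4 ⊢
  omega

end CounterPoly

/-! ### A library of functions computed by counter programs -/

/-- The predicate `p` is decided by a counter program in polynomial time. -/
def CounterDecidable {k : ℕ} (p : (Fin k → ℕ) → Prop) [DecidablePred p] : Prop :=
  CounterPoly fun v => if p v then 1 else 0

namespace CounterPoly

variable {k : ℕ} {f g : (Fin k → ℕ) → ℕ} {p q : (Fin k → ℕ) → Prop} [DecidablePred p]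
  [DecidablePred q]

theorem congr (hf : CounterPoly f) (h : ∀ v, g v = f v) : CounterPoly g :=
  (funext h : g = f) ▸ hf

/-- A new first variable, on which the function does not depend; the bodies of sums, recursions and
bounded quantifiers have the bound variable in this place. -/
theorem weaken (hf : CounterPoly f) : CounterPoly fun u : Fin (k + 1) → ℕ => f fun i => u i.succ :=
  hf.rename Fin.succ

theorem weaken₂ (hf : CounterPoly f) :
    CounterPoly fun u : Fin (k + 2) → ℕ => f fun i => u i.succ.succ :=
  hf.rename fun i => i.succ.succ

theorem comp₁ {F : ℕ → ℕ} (hF : CounterPoly fun v : Fin 1 → ℕ => F (v 0)) (hf : CounterPoly f) :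
    CounterPoly fun v => F (f v) :=
  (hF.rename fun _ => (0 : Fin (k + 1))).bind hf

theorem const (n : ℕ) : CounterPoly fun _ : Fin k → ℕ => n := by
  induction n with
  | zero => exact zero
  | succ n ih => exact ih.add one

theorem pred (hf : CounterPoly f) : CounterPoly fun v => f v - 1 := by
  refine comp₁ (F := fun n => n - 1) ?_ hf
  refine ((prec (g := fun _ : Fin 1 → ℕ => 0) (h := fun _ i _ => i) zero (proj 0) (proj 0)
    (B := fun v => v 0) (.proj 0) ?_)).congr ?_
  · intro v i hi
    cases i <;> simp; omega
  · intro v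
    cases v 0 <;> rfl

theorem sub (hf : CounterPoly f) (hg : CounterPoly g) : CounterPoly fun v => f v - g v := by
  have key : ∀ a b : ℕ, Nat.rec (motive := fun _ => ℕ) a (fun _ acc => acc - 1) b = a - b := by
    intro a b
    induction b with
    | zero => rfl
    | succ b ih => simp only [ih]; omega
  refine (prec (h := fun _ _ acc => acc - 1) hf (proj 1).pred hg hf.1 ?_).congr fun v => ?_
  · intro v i _
    rw [key]; omega
  · exact (key _ _).symm

theorem sum {f : (Fin k → ℕ) → ℕ → ℕ} {n : (Fin k → ℕ) → ℕ}
    (hf : CounterPoly fun u : Fin (k + 1) → ℕ => f (fun i => u i.succ) (u 0))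
    (hn : CounterPoly n) : CounterPoly fun v => ∑ i ∈ Finset.range (n v), f v i := by
  have key : ∀ v m, Nat.rec (motive := fun _ => ℕ) 0 (fun i acc => acc + f v i) m =
      ∑ i ∈ Finset.range m, f v i := by
    intro v m
    induction m with
    | zero => rfl
    | succ m ih => simp only [ih, Finset.sum_range_succ]
  obtain ⟨P, hP⟩ := hf.1
  obtain ⟨Q, hQ⟩ := hn.1
  have hB : PolyBdd fun v => ∑ i ∈ Finset.range (n v), f v i := by
    refine ⟨Q * P.comp (Q + Polynomial.X), fun v => ?_⟩
    calc ∑ i ∈ Finset.range (n v), f v i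
        ≤ ∑ _i ∈ Finset.range (n v), P.eval (n v + ∑ i, v i) := by
          refine Finset.sum_le_sum fun i hi => ?_
          have := hP (Fin.cons i v)
          rw [Fin.sum_cons] at this
          exact this.trans (P.eval_mono_nat (by have := Finset.mem_range.1 hi; omega))
      _ = n v * P.eval (n v + ∑ i, v i) := by simp
      _ ≤ _ := by
          simp only [Polynomial.eval_mul, Polynomial.eval_comp, Polynomial.eval_add,
            Polynomial.eval_X]
          exact Nat.mul_le_mul (hQ v) (P.eval_mono_nat (Nat.add_le_add_right (hQ v) _))
  refine (prec (h := fun v i acc => acc + f v i) zero ((proj 1).add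
    (hf.rename (Fin.cases (0 : Fin (k + 2)) fun i => i.succ.succ))) hn hB ?_).congr fun v => ?_
  · intro v i hi
    rw [key]
    exact Finset.sum_le_sum_of_subset (by simpa using hi)
  · exact (key _ _).symm

theorem mul (hf : CounterPoly f) (hg : CounterPoly g) : CounterPoly fun v => f v * g v :=
  (sum (f := fun v _ => g v) hg.weaken hf).congr fun v => by simp

theorem pow (hf : CounterPoly f) (a : ℕ) : CounterPoly fun v => f v ^ a := by
  induction a with
  | zero => exact one
  | succ a ih => exact ih.mul hf

theorem ite (hp : CounterDecidable p) (hf : CounterPoly f) (hg : CounterPoly g) :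
    CounterPoly fun v => if p v then f v else g v :=
  ((hp.mul hf).add ((one.sub hp).mul hg)).congr fun v => by by_cases h : p v <;> simp [h]

end CounterPoly

namespace CounterDecidable

open CounterPoly

variable {k : ℕ} {f g : (Fin k → ℕ) → ℕ} {p q : (Fin k → ℕ) → Prop} [DecidablePred p]
  [DecidablePred q]

theorem lt (hf : CounterPoly f) (hg : CounterPoly g) : CounterDecidable fun v => f v < g v :=
  (one.sub (one.sub (hg.sub hf))).congr fun v => by split_ifs <;> omega

theorem not (hp : CounterDecidable p) : CounterDecidable fun v => ¬ p v :=
  (one.sub hp).congr fun v => by by_cases h : p v <;> simp [h]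

theorem and (hp : CounterDecidable p) (hq : CounterDecidable q) :
    CounterDecidable fun v => p v ∧ q v :=
  (CounterPoly.mul hp hq).congr fun v => by by_cases h : p v <;> by_cases h' : q v <;> simp [h, h']

theorem congr (hp : CounterDecidable p) (h : ∀ v, q v ↔ p v) : CounterDecidable q :=
  CounterPoly.congr hp fun v => by simp [h]

theorem le (hf : CounterPoly f) (hg : CounterPoly g) : CounterDecidable fun v => f v ≤ g v :=
  (lt hg hf).not.congr fun _ => not_lt.symm

theorem eq (hf : CounterPoly f) (hg : CounterPoly g) : CounterDecidable fun v => f v = g v :=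
  ((le hf hg).and (le hg hf)).congr fun _ => le_antisymm_iff

theorem ball {p : (Fin k → ℕ) → ℕ → Prop} [∀ v, DecidablePred (p v)] {n : (Fin k → ℕ) → ℕ}
    (hp : CounterDecidable fun u : Fin (k + 1) → ℕ => p (fun i => u i.succ) (u 0))
    (hn : CounterPoly n) : CounterDecidable fun v => ∀ i < n v, p v i :=
  (eq (CounterPoly.sum (f := fun v i => if ¬ p v i then 1 else 0) hp.not hn) zero).congr fun v => by
    simp

end CounterDecidable

namespace CounterPoly

open CounterDecidable

variable {k : ℕ} {f g : (Fin k → ℕ) → ℕ}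

theorem div (hf : CounterPoly f) (hg : CounterPoly g) : CounterPoly fun v => f v / g v := by
  refine (ite (lt zero hg) (sum (f := fun v i => if (i + 1) * g v ≤ f v then 1 else 0)
    (le (((proj 0).add one).mul hg.weaken) hf.weaken) hf) zero).congr fun v => ?_
  split_ifs with h
  · rw [Finset.sum_boole, Nat.cast_id]
    have : {i ∈ Finset.range (f v) | (i + 1) * g v ≤ f v} = Finset.range (f v / g v) := by
      ext i
      rw [Finset.mem_filter, Finset.mem_range, Finset.mem_range, ← Nat.le_div_iff_mul_le h,
        Nat.succ_le_iff]
      exact ⟨fun h => h.2, fun h' => ⟨h'.trans_le (Nat.div_le_self _ _), h'⟩⟩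
    rw [this, Finset.card_range]
  · rw [Nat.eq_zero_of_not_pos h, Nat.div_zero]

theorem mod (hf : CounterPoly f) (hg : CounterPoly g) : CounterPoly fun v => f v % g v :=
  (hf.sub (hg.mul (hf.div hg))).congr fun v => by
    have := Nat.div_add_mod (f v) (g v)
    omega

theorem shiftRight (hf : CounterPoly f) (hg : CounterPoly g) :
    CounterPoly fun v => f v >>> g v := by
  have key : ∀ a b : ℕ, Nat.rec (motive := fun _ => ℕ) a (fun _ acc => acc / 2) b = a >>> b := by
    intro a b
    induction b with
    | zero => rfl
    | succ b ih => simp only [ih]; rfl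
  refine (prec (h := fun _ _ acc => acc / 2) hf ((proj 1).div (const 2)) hg hf.1 ?_).congr
    fun v => ?_
  · intro v i _
    rw [key]
    exact Nat.shiftRight_le _ _
  · exact (key _ _).symm

end CounterPoly

theorem Nat.xor_le_add (a b : ℕ) : a ^^^ b ≤ a + b := by
  induction a using Nat.strong_induction_on generalizing b with
  | _ a ih =>
    rcases Nat.eq_zero_or_pos a with rfl | ha
    · simp
    · have h1 := ih (a / 2) (by omega) (b / 2)
      have h2 := Nat.div_add_mod (a ^^^ b) 2
      rw [Nat.xor_div_two, Nat.xor_mod_two_eq] at h2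
      omega

namespace CounterPoly

open CounterDecidable

variable {k : ℕ} {f g : (Fin k → ℕ) → ℕ}

/-- The bits of the two numbers are combined one by one, the most significant ones first. -/
theorem xor (hf : CounterPoly f) (hg : CounterPoly g) : CounterPoly fun v => f v ^^^ g v := by
  have key : ∀ a b i : ℕ, i ≤ a + b → Nat.rec (motive := fun _ => ℕ) 0 (fun i acc => 2 * acc +
      (a >>> (a + b - 1 - i) + b >>> (a + b - 1 - i)) % 2) i = (a ^^^ b) >>> (a + b - i) := by
    intro a b i hi
    induction i with
    | zero =>
      refine (Nat.shiftRight_eq_zero _ _ (Nat.xor_lt_two_pow ?_ ?_)).symm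
      · exact Nat.lt_two_pow_self.trans_le (Nat.pow_le_pow_right two_pos (by omega))
      · exact Nat.lt_two_pow_self.trans_le (Nat.pow_le_pow_right two_pos (by omega))
    | succ i ih =>
      simp only [ih (by omega)]
      rw [show a + b - i = a + b - (i + 1) + 1 by omega, Nat.sub_sub, Nat.add_comm 1 i,
        Nat.shiftRight_succ, ← Nat.xor_mod_two_eq, ← Nat.shiftRight_xor_distrib]
      omega
  refine (prec (h := fun v i acc => 2 * acc + (f v >>> (f v + g v - 1 - i) +
    g v >>> (f v + g v - 1 - i)) % 2) zero ?_ (hf.add hg) (B := fun v => f v + g v)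
    (hf.1.add hg.1) ?_).congr fun v => ?_
  · have h := ((hf.add hg).weaken₂.sub one).sub (proj 0)
    exact ((const 2).mul (proj 1)).add (((hf.weaken₂.shiftRight h).add
      (hg.weaken₂.shiftRight h)).mod (const 2))
  · intro v i hi
    rw [key _ _ i hi]
    exact (Nat.shiftRight_le _ _).trans (Nat.xor_le_add _ _)
  · rw [key _ _ _ le_rfl, Nat.sub_self, Nat.shiftRight_zero]

end CounterPoly

/-! ### Finite field arithmetic on natural numbers -/

/-- The least power of two that is at least `b`. -/
def leastPowGe (b : ℕ) : ℕ := Nat.rec 1 (fun _ acc => if acc < b then 2 * acc else acc) b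

/-- Multiplication by `X` modulo a polynomial: binary polynomials are written as natural numbers
(the bits are the coefficients), `h` is the modulus, of degree `r`, and `q = 2 ^ r`. -/
def timesX (q h u : ℕ) : ℕ := if 2 * u < q then 2 * u else (2 * u) ^^^ h

/-- The product of the binary polynomials `u` and `v` modulo `h`, by Horner's rule over the
bits of `v`. The cut-off at `q` has no effect if `h` is a modulus with `q ≤ h < 2 * q`
and `u < q`; it keeps the values polynomially bounded for all arguments. -/
def fieldMul (q h u v : ℕ) : ℕ :=
  Nat.rec 0 (fun i acc => min q
    (timesX q h acc ^^^ (if (v >>> (v - 1 - i)) % 2 = 1 then u else 0))) v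

/-- The power `u ^ i` of binary polynomials modulo `h`. -/
def fieldPow (q h u i : ℕ) : ℕ := Nat.rec 1 (fun _ acc => fieldMul q h acc u) i

/-- The product modulo `h` has no zero divisors. -/
def IsFieldModulus (q h : ℕ) : Prop :=
  ∀ u < q, ∀ v < q, ¬ (fieldMul q h u v = 0 ∧ u ≠ 0 ∧ v ≠ 0)

instance (q h : ℕ) : Decidable (IsFieldModulus q h) := by unfold IsFieldModulus; infer_instance

/-- The least modulus `h ≥ q` whose product has no zero divisors (if there is one below `2 * q`),
found by exhaustive search. -/
def fieldModulus (q : ℕ) : ℕ :=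
  q + ∑ i ∈ Finset.range q, if ∀ j < i + 1, ¬ IsFieldModulus q (q + j) then 1 else 0

theorem fieldMul_le (q h u v : ℕ) : fieldMul q h u v ≤ q := by
  unfold fieldMul
  cases v with
  | zero => simp
  | succ v => exact min_le_left _ _

/-- After `i` rounds of doubling. -/
theorem leastPowGe_aux (b i : ℕ) : ∃ r ≤ i, Nat.rec (motive := fun _ => ℕ) 1
    (fun _ acc => if acc < b then 2 * acc else acc) i = 2 ^ r ∧ (b ≤ 2 ^ r ∨ r = i) ∧
    (r = 0 ∨ 2 ^ r < 2 * b) := by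
  induction i with
  | zero => exact ⟨0, le_rfl, rfl, .inr rfl, .inl rfl⟩
  | succ i ih =>
    obtain ⟨r, hr, h1, h2, h3⟩ := ih
    simp only [h1]
    by_cases hb : 2 ^ r < b
    · refine ⟨r + 1, by omega, by rw [if_pos hb, pow_succ, mul_comm], .inr ?_, .inr ?_⟩
      · omega
      · rw [pow_succ]; omega
    · exact ⟨r, by omega, by rw [if_neg hb], .inl (by omega), h3⟩

theorem exists_leastPowGe_eq (b : ℕ) :
    ∃ r, leastPowGe b = 2 ^ r ∧ b ≤ 2 ^ r ∧ (r = 0 ∨ 2 ^ r < 2 * b) := by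
  obtain ⟨r, hr, h1, h2, h3⟩ := leastPowGe_aux b b
  refine ⟨r, h1, h2.elim id fun h => ?_, h3⟩
  rw [h]; exact Nat.lt_two_pow_self.le

namespace CounterPoly

open CounterDecidable

variable {k : ℕ} {q h f g : (Fin k → ℕ) → ℕ}

theorem leastPowGe (hf : CounterPoly f) : CounterPoly fun v => leastPowGe (f v) := by
  refine (prec (g := fun _ => 1) (h := fun v _ acc => if acc < f v then 2 * acc else acc) one
    (ite (lt (proj 1) hf.weaken₂) ((const 2).mul (proj 1)) (proj 1)) hf
    (((PolyBdd.const 2).mul hf.1).add (.const 1)) fun v i _ => ?_)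
  obtain ⟨r, -, h1, -, h3⟩ := leastPowGe_aux (f v) i
  rw [h1]
  rcases h3 with rfl | h3 <;> omega

theorem timesX (hq : CounterPoly q) (hh : CounterPoly h) (hf : CounterPoly f) :
    CounterPoly fun v => timesX (q v) (h v) (f v) :=
  have h2 := (const 2).mul hf
  ite (lt h2 hq) h2 (h2.xor hh)

theorem fieldMul (hq : CounterPoly q) (hh : CounterPoly h) (hf : CounterPoly f)
    (hg : CounterPoly g) : CounterPoly fun v => fieldMul (q v) (h v) (f v) (g v) := by
  have hmin : ∀ {k : ℕ} {a b : (Fin k → ℕ) → ℕ}, CounterPoly a → CounterPoly b →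
      CounterPoly fun v => min (a v) (b v) := fun ha hb =>
    (ite (le ha hb) ha hb).congr fun v => by rw [min_def]
  refine (prec (h := fun v i acc => min (q v) (_root_.timesX (q v) (h v) acc ^^^
    (if (g v >>> (g v - 1 - i)) % 2 = 1 then f v else 0))) zero ?_ hg hq.1 fun v i _ => ?_)
  · exact hmin hq.weaken₂ ((timesX hq.weaken₂ hh.weaken₂ (proj 1)).xor
      (ite (eq ((hg.weaken₂.shiftRight ((hg.weaken₂.sub one).sub (proj 0))).mod (const 2)) one)
        hf.weaken₂ zero))
  · cases i with
    | zero => exact Nat.zero_le _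
    | succ i => exact min_le_left _ _

theorem fieldPow (hq : CounterPoly q) (hh : CounterPoly h) (hf : CounterPoly f)
    (hg : CounterPoly g) : CounterPoly fun v => fieldPow (q v) (h v) (f v) (g v) := by
  refine (prec (g := fun _ => 1) (h := fun v _ acc => _root_.fieldMul (q v) (h v) acc (f v)) one
    (fieldMul hq.weaken₂ hh.weaken₂ (proj 1) hf.weaken₂) hg (hq.1.add (.const 1)) fun v i _ => ?_)
  cases i with
  | zero => exact Nat.le_add_left _ _
  | succ i => exact (fieldMul_le _ _ _ _).trans (Nat.le_add_right _ _)

theorem isFieldModulus (hq : CounterPoly q) (hh : CounterPoly h) :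
    CounterDecidable fun v => IsFieldModulus (q v) (h v) := by
  refine (ball (p := fun v i => ∀ j < q v,
    ¬ (_root_.fieldMul (q v) (h v) i j = 0 ∧ i ≠ 0 ∧ j ≠ 0))
    (ball (p := fun u j => ¬ (_root_.fieldMul (q fun i => u i.succ) (h fun i => u i.succ) (u 0) j = 0
      ∧ u 0 ≠ 0 ∧ j ≠ 0)) ?_ hq.weaken) hq).congr fun v => Iff.rfl
  exact ((eq (fieldMul hq.weaken₂ hh.weaken₂ (proj 1) (proj 0)) zero).and
    ((eq (proj 1) zero).not.and (eq (proj 0) zero).not)).not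

theorem fieldModulus (hq : CounterPoly q) : CounterPoly fun v => fieldModulus (q v) :=
  hq.add (sum (f := fun v i => if ∀ j < i + 1, ¬ IsFieldModulus (q v) (q v + j) then 1 else 0)
    (ball (p := fun u j => ¬ IsFieldModulus (q fun i => u i.succ) ((q fun i => u i.succ) + j))
      (isFieldModulus hq.weaken₂ (hq.weaken₂.add (proj 0))).not ((proj 0).add one)) hq)

end CounterPoly

/-! ### The field encoded by natural numbers -/

section FieldModel

open Polynomial

/-- The binary polynomial whose coefficients are the binary digits of `u`. -/
noncomputable def bitPoly (u : ℕ) : (ZMod 2)[X] :=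
  ∑ i ∈ Finset.range u, if u.testBit i then X ^ i else 0

theorem coeff_bitPoly (u i : ℕ) : (bitPoly u).coeff i = if u.testBit i then 1 else 0 := by
  unfold bitPoly
  rw [finsetSum_coeff]
  have h : ∀ j ∈ Finset.range u, (if u.testBit j then (X ^ j : (ZMod 2)[X]) else 0).coeff i =
      if i = j then (if u.testBit i then 1 else 0) else 0 := by
    intro j _
    by_cases hij : i = j
    · subst hij; rw [if_pos rfl]; split_ifs <;> simp
    · rw [if_neg hij]; split_ifs <;> simp [coeff_X_pow, hij]
  rw [Finset.sum_congr rfl h, Finset.sum_ite_eq]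
  split_ifs with h1 h2 h2
  · rfl
  · rfl
  · exact absurd (Finset.mem_range.2 (Nat.lt_two_pow_self.trans_le (Nat.ge_two_pow_of_testBit h2)))
      h1
  · rfl

theorem bitPoly_xor (u v : ℕ) : bitPoly (u ^^^ v) = bitPoly u + bitPoly v := by
  ext i
  rw [coeff_add]
  simp only [coeff_bitPoly, Nat.testBit_xor]
  cases u.testBit i <;> cases v.testBit i <;> decide

theorem bitPoly_two_mul (u : ℕ) : bitPoly (2 * u) = X * bitPoly u := by
  ext i
  cases i with
  | zero => simp [coeff_bitPoly]
  | succ i => simp [coeff_X_mul, coeff_bitPoly, Nat.testBit_succ]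

theorem bitPoly_zero : bitPoly 0 = 0 := by simp [bitPoly]

theorem bitPoly_one : bitPoly 1 = 1 := by simp [bitPoly]

theorem bitPoly_injective : Function.Injective bitPoly := by
  intro u v h
  refine Nat.eq_of_testBit_eq fun i => ?_
  have := congrArg (fun p => p.coeff i) h
  simp only [coeff_bitPoly] at this
  cases hu : u.testBit i <;> cases hv : v.testBit i <;> simp_all

theorem degree_bitPoly_lt {u r : ℕ} (h : u < 2 ^ r) : (bitPoly u).degree < r := by
  rw [degree_lt_iff_coeff_zero]
  intro i hi
  rw [coeff_bitPoly, Nat.testBit_lt_two_pow (h.trans_le (Nat.pow_le_pow_right two_pos hi))]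
  rfl

theorem exists_bitPoly_eq {f : (ZMod 2)[X]} {r : ℕ} (h : f.degree < r) :
    ∃ u < 2 ^ r, bitPoly u = f := by
  refine ⟨Nat.ofBits fun i : Fin r => decide (f.coeff i = 1), Nat.ofBits_lt_two_pow _, ?_⟩
  ext i
  rw [coeff_bitPoly]
  by_cases hi : i < r
  · rw [Nat.testBit_ofBits_lt _ _ hi]
    generalize f.coeff i = a
    revert a
    decide
  · rw [Nat.testBit_ofBits_ge _ _ (by omega), (degree_lt_iff_coeff_zero _ _).1 h _ (by omega)]
    rfl

theorem bitPoly_eq_X_mul_add (u : ℕ) :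
    bitPoly u = X * bitPoly (u / 2) + if u % 2 = 1 then 1 else 0 := by
  ext i
  cases i with
  | zero => by_cases h : u % 2 = 1 <;> simp [coeff_bitPoly, h]
  | succ i =>
    rw [coeff_add, coeff_X_mul, coeff_bitPoly, coeff_bitPoly, Nat.testBit_succ]
    split_ifs <;> simp [coeff_one]

variable {r h : ℕ}

theorem bitPoly_modulus_monic (h1 : 2 ^ r ≤ h) (h2 : h < 2 * 2 ^ r) :
    (bitPoly h).Monic ∧ (bitPoly h).degree = r := by
  have hd : (bitPoly h).degree < (r + 1 : ℕ) := degree_bitPoly_lt (by rw [pow_succ]; omega)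
  have hc : (bitPoly h).coeff r = 1 := by
    have hb : h.testBit r = true := by
      rw [Nat.testBit_eq_decide_div_mod_eq, Nat.div_eq_of_lt_le (k := 1) (by omega) (by omega)]
      rfl
    rw [coeff_bitPoly, hb]
    rfl
  have hdeg : (bitPoly h).degree = r := by
    refine le_antisymm (degree_le_of_natDegree_le (Nat.lt_succ_iff.1 (natDegree_lt_iff_degree_lt
      (fun h0 => ?_) |>.2 hd))) ?_
    · rw [h0, coeff_zero] at hc; exact zero_ne_one hc
    exact le_degree_of_ne_zero (by rw [hc]; exact one_ne_zero)
  refine ⟨?_, hdeg⟩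
  rw [Monic, leadingCoeff, natDegree_eq_of_degree_eq_some hdeg, hc]

theorem timesX_lt (h1 : 2 ^ r ≤ h) (h2 : h < 2 * 2 ^ r) {u : ℕ} (hu : u < 2 ^ r) :
    timesX (2 ^ r) h u < 2 ^ r := by
  unfold timesX
  split_ifs with hlt
  · exact hlt
  · have e1 : 2 * u / 2 ^ r = 1 := Nat.div_eq_of_lt_le (by omega) (by omega)
    have e2 : h / 2 ^ r = 1 := Nat.div_eq_of_lt_le (by omega) (by omega)
    have e3 : (2 * u ^^^ h) / 2 ^ r = 0 := by rw [Nat.xor_div_two_pow, e1, e2]; rfl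
    exact (Nat.div_eq_zero_iff_lt (by positivity)).1 e3

/-- The residue class, modulo the polynomial written as `h`, of the polynomial written as `u`. -/
noncomputable def residue (h u : ℕ) : AdjoinRoot (bitPoly h) := AdjoinRoot.mk _ (bitPoly u)

theorem residue_xor (u v : ℕ) : residue h (u ^^^ v) = residue h u + residue h v := by
  simp [residue, bitPoly_xor]

theorem residue_timesX (q u : ℕ) :
    residue h (timesX q h u) = AdjoinRoot.mk _ X * residue h u := by
  have h2 : residue h (2 * u) = AdjoinRoot.mk _ X * residue h u := by
    rw [residue, bitPoly_two_mul, map_mul, residue]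
  unfold timesX
  split_ifs
  · exact h2
  · rw [residue_xor, h2]
    simp [residue]

/-- As long as the codes are below `2 ^ r`, the cut-off in `fieldMul` is never reached, and Horner's
rule computes the product of the residue classes. -/
theorem fieldMul_spec (h1 : 2 ^ r ≤ h) (h2 : h < 2 * 2 ^ r) {u : ℕ} (hu : u < 2 ^ r) (v : ℕ) :
    fieldMul (2 ^ r) h u v < 2 ^ r ∧
      residue h (fieldMul (2 ^ r) h u v) = residue h u * residue h v := by
  have key : ∀ i ≤ v, ∃ a, Nat.rec (motive := fun _ => ℕ) 0 (fun i acc => min (2 ^ r)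
      (timesX (2 ^ r) h acc ^^^ (if (v >>> (v - 1 - i)) % 2 = 1 then u else 0))) i = a ∧
      a < 2 ^ r ∧ residue h a = residue h u * residue h (v >>> (v - i)) := by
    intro i hi
    induction i with
    | zero =>
      refine ⟨0, rfl, by positivity, ?_⟩
      rw [Nat.shiftRight_eq_zero v _ (by simpa using Nat.lt_two_pow_self)]
      simp [residue, bitPoly_zero]
    | succ i ih =>
      obtain ⟨a, ha, hlt, hres⟩ := ih (by omega)
      refine ⟨_, rfl, ?_⟩
      simp only [ha]
      rw [Nat.sub_sub, Nat.add_comm 1 i]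
      have hs : v >>> (v - i) = v >>> (v - (i + 1)) / 2 := by
        rw [← Nat.shiftRight_succ]
        congr 1
        omega
      have hlt' : timesX (2 ^ r) h a ^^^ (if v >>> (v - (i + 1)) % 2 = 1 then u else 0) <
          2 ^ r := Nat.xor_lt_two_pow (timesX_lt h1 h2 hlt) (by split_ifs; exacts [hu, by positivity])
      rw [min_eq_right hlt'.le]
      refine ⟨hlt', ?_⟩
      rw [residue_xor, residue_timesX, hres, hs]
      have hv : residue h (v >>> (v - (i + 1))) = AdjoinRoot.mk _ X *
          residue h (v >>> (v - (i + 1)) / 2) +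
            if v >>> (v - (i + 1)) % 2 = 1 then 1 else 0 := by
        rw [residue, bitPoly_eq_X_mul_add (v >>> (v - (i + 1))), map_add, map_mul, residue]
        split_ifs <;> simp
      rw [hv]
      split_ifs
      · ring
      · rw [residue, residue, residue, bitPoly_zero, map_zero]; ring
  obtain ⟨a, ha, hlt, hres⟩ := key v le_rfl
  rw [Nat.sub_self, Nat.shiftRight_zero] at hres
  have ha' : fieldMul (2 ^ r) h u v = a := ha
  rw [ha']
  exact ⟨hlt, hres⟩

theorem residue_injOn (h1 : 2 ^ r ≤ h) (h2 : h < 2 * 2 ^ r) {u v : ℕ} (hu : u < 2 ^ r)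
    (hv : v < 2 ^ r) (huv : residue h u = residue h v) : u = v := by
  have hx : bitPoly h ∣ bitPoly (u ^^^ v) := by
    rw [← AdjoinRoot.mk_eq_zero]
    change residue h (u ^^^ v) = 0
    rw [residue_xor, huv, ← residue_xor, Nat.xor_self, residue, bitPoly_zero, map_zero]
  have h0 := eq_zero_of_dvd_of_degree_lt hx (by
    rw [(bitPoly_modulus_monic h1 h2).2]
    exact degree_bitPoly_lt (Nat.xor_lt_two_pow hu hv))
  rw [← bitPoly_zero] at h0
  exact Nat.xor_eq_zero_iff.1 (bitPoly_injective h0)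

theorem residue_surjOn (h1 : 2 ^ r ≤ h) (h2 : h < 2 * 2 ^ r) (a : AdjoinRoot (bitPoly h)) :
    ∃ u < 2 ^ r, residue h u = a := by
  obtain ⟨f, rfl⟩ := AdjoinRoot.mk_surjective a
  obtain ⟨hm, hd⟩ := bitPoly_modulus_monic h1 h2
  obtain ⟨u, hu, hf⟩ := exists_bitPoly_eq (f := f %ₘ bitPoly h) (r := r)
    (hd ▸ degree_modByMonic_lt f hm)
  refine ⟨u, hu, ?_⟩
  rw [residue, hf, modByMonic_eq_sub_mul_div f]
  simp

/-- There is an irreducible binary polynomial of every positive degree. -/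
theorem exists_isFieldModulus (hr : r ≠ 0) : ∃ j < 2 ^ r, IsFieldModulus (2 ^ r) (2 ^ r + j) := by
  -- a minimal polynomial of a primitive element of the field with `2 ^ r` elements
  obtain ⟨f, hirr, hm, hdeg⟩ : ∃ f : (ZMod 2)[X], Irreducible f ∧ f.Monic ∧ f.natDegree = r := by
    obtain ⟨α, hα⟩ := Field.exists_primitive_element (ZMod 2) (GaloisField 2 r)
    have hint : IsIntegral (ZMod 2) α := Algebra.IsIntegral.isIntegral α
    refine ⟨minpoly (ZMod 2) α, minpoly.irreducible hint, minpoly.monic hint, ?_⟩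
    rw [(Field.primitive_element_iff_minpoly_natDegree_eq (ZMod 2) α).1 hα, GaloisField.finrank 2 hr]
  obtain ⟨h, hlt, rfl⟩ := exists_bitPoly_eq (f := f) (r := r + 1) (by
    rw [degree_eq_natDegree hirr.ne_zero, hdeg]; exact_mod_cast Nat.lt_succ_self r)
  have hle : 2 ^ r ≤ h := by
    by_contra hlt
    have := degree_bitPoly_lt (not_le.1 hlt)
    rw [degree_eq_natDegree hirr.ne_zero, hdeg] at this
    exact lt_irrefl _ this
  rw [pow_succ] at hlt
  refine ⟨h - 2 ^ r, by omega, ?_⟩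
  rw [Nat.add_sub_cancel' hle]
  rintro u hu v hv ⟨h0, hu0, hv0⟩
  have hdom : IsDomain (AdjoinRoot (bitPoly h)) := AdjoinRoot.isDomain_of_prime hirr.prime
  have hmul := (fieldMul_spec hle (by omega) hu v).2
  have z : residue h 0 = 0 := by rw [residue, bitPoly_zero, map_zero]
  rw [h0, z, eq_comm, mul_eq_zero, ← z] at hmul
  rcases hmul with hmul | hmul
  · exact hu0 (residue_injOn hle (by omega) hu (by positivity) hmul)
  · exact hv0 (residue_injOn hle (by omega) hv (by positivity) hmul)

theorem fieldModulus_spec (hr : r ≠ 0) : 2 ^ r ≤ fieldModulus (2 ^ r) ∧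
    fieldModulus (2 ^ r) < 2 * 2 ^ r ∧ IsFieldModulus (2 ^ r) (fieldModulus (2 ^ r)) := by
  classical
  have hex := exists_isFieldModulus hr
  have hex' : ∃ j, IsFieldModulus (2 ^ r) (2 ^ r + j) := let ⟨j, _, hj⟩ := hex; ⟨j, hj⟩
  have hlt : Nat.find hex' < 2 ^ r := let ⟨j, h, hj⟩ := hex; (Nat.find_min' hex' hj).trans_lt h
  have : fieldModulus (2 ^ r) = 2 ^ r + Nat.find hex' := by
    unfold fieldModulus
    rw [Finset.sum_boole, Nat.cast_id]
    congr 1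
    have : {i ∈ Finset.range (2 ^ r) | ∀ j < i + 1, ¬ IsFieldModulus (2 ^ r) (2 ^ r + j)} =
        Finset.range (Nat.find hex') := by
      ext i
      rw [Finset.mem_filter, Finset.mem_range, Finset.mem_range]
      constructor
      · rintro ⟨-, hi⟩
        by_contra hle
        exact hi _ (by omega) (Nat.find_spec hex')
      · intro hi
        exact ⟨hi.trans hlt, fun j hj => Nat.find_min hex' (by omega)⟩
    rw [this, Finset.card_range]
  rw [this]
  exact ⟨by omega, by omega, Nat.find_spec hex'⟩

/-- A finite field, encoded by the natural numbers below `q`: addition is bitwise, multiplication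
is `fieldMul q h`, and the lowest bit is a nonzero additive functional. -/
structure FieldModel (q h : ℕ) where
  /-- the field -/
  K : Type
  /-- its ring structure -/
  [ring : CommRing K]
  [dom : IsDomain K]
  [fin : Fintype K]
  /-- the element encoded by a natural number -/
  dec : ℕ → K
  /-- the code of an element -/
  enc : K → ℕ
  enc_lt : ∀ a, enc a < q
  dec_enc : ∀ a, dec (enc a) = a
  enc_dec : ∀ u < q, enc (dec u) = u
  dec_one : dec 1 = 1
  xor_lt : ∀ u < q, ∀ v < q, u ^^^ v < q
  dec_xor : ∀ u v, dec (u ^^^ v) = dec u + dec v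
  mul_lt : ∀ u < q, ∀ v, fieldMul q h u v < q
  dec_mul : ∀ u < q, ∀ v, dec (fieldMul q h u v) = dec u * dec v

attribute [instance] FieldModel.ring FieldModel.dom FieldModel.fin

theorem exists_fieldModel (hr : r ≠ 0) :
    Nonempty (FieldModel (2 ^ r) (fieldModulus (2 ^ r))) := by
  obtain ⟨h1, h2, hf⟩ := fieldModulus_spec hr
  set h := fieldModulus (2 ^ r)
  choose enc henc hdec using residue_surjOn h1 h2
  have hfin : Finite (AdjoinRoot (bitPoly h)) := by
    refine Finite.of_injective (fun a => (⟨enc a, henc a⟩ : Fin (2 ^ r))) fun a b hab => ?_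
    rw [← hdec a, ← hdec b, Fin.mk.inj_iff.1 hab]
  have z : residue h 0 = 0 := by rw [residue, bitPoly_zero, map_zero]
  have o : residue h 1 = 1 := by rw [residue, bitPoly_one, map_one]
  have one_lt : 1 < 2 ^ r := Nat.one_lt_two_pow hr
  have hnt : Nontrivial (AdjoinRoot (bitPoly h)) := ⟨0, 1, fun h01 => by
    rw [← z, ← o] at h01
    exact absurd (residue_injOn h1 h2 (by omega) one_lt h01) (by decide)⟩
  have hnz : NoZeroDivisors (AdjoinRoot (bitPoly h)) := ⟨fun {a b} hab => by
    have hmul := fieldMul_spec h1 h2 (henc a) (enc b)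
    rw [hdec, hdec, hab, ← z] at hmul
    by_contra hne
    rw [not_or] at hne
    refine hf _ (henc a) _ (henc b) ⟨residue_injOn h1 h2 hmul.1 (by omega) hmul.2, fun h0 => ?_,
      fun h0 => ?_⟩
    · exact hne.1 (by rw [← hdec a, h0, z])
    · exact hne.2 (by rw [← hdec b, h0, z])⟩
  have hdom : IsDomain (AdjoinRoot (bitPoly h)) := NoZeroDivisors.to_isDomain _
  exact ⟨{
    K := AdjoinRoot (bitPoly h)
    fin := Fintype.ofFinite _
    dec := residue h
    enc := enc
    enc_lt := henc
    dec_enc := hdec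
    enc_dec := fun u hu => residue_injOn h1 h2 (henc _) hu (hdec _)
    dec_one := o
    xor_lt := fun u hu v hv => Nat.xor_lt_two_pow hu hv
    dec_xor := residue_xor
    mul_lt := fun u hu v => (fieldMul_spec h1 h2 hu v).1
    dec_mul := fun u hu v => (fieldMul_spec h1 h2 hu v).2 }⟩

namespace FieldModel

variable {q : ℕ} (M : FieldModel q h)

theorem dec_injOn {u v : ℕ} (hu : u < q) (hv : v < q) (huv : M.dec u = M.dec v) : u = v := by
  rw [← M.enc_dec u hu, ← M.enc_dec v hv, huv]

theorem enc_injective : Function.Injective M.enc := fun a b hab => by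
  rw [← M.dec_enc a, ← M.dec_enc b, hab]

theorem one_lt (M : FieldModel q h) : 1 < q := by
  have h0 := M.enc_lt 0
  have h1 := M.enc_lt 1
  have := M.enc_injective.ne (zero_ne_one (α := M.K))
  omega

theorem card_eq : Fintype.card M.K = q := by
  refine (Fintype.card_of_bijective (f := fun a => (⟨M.enc a, M.enc_lt a⟩ : Fin q)) ⟨?_, ?_⟩).trans
    (Fintype.card_fin q)
  · intro a b hab
    exact M.enc_injective (Fin.mk.inj_iff.1 hab)
  · intro u
    exact ⟨M.dec u, Fin.ext (M.enc_dec u u.2)⟩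

theorem enc_add (a b : M.K) : M.enc (a + b) = M.enc a ^^^ M.enc b := by
  have := M.enc_dec _ (M.xor_lt _ (M.enc_lt a) _ (M.enc_lt b))
  rwa [M.dec_xor, M.dec_enc, M.dec_enc] at this

/-- The lowest bit, as an additive functional. -/
def lowBit : M.K →+ ZMod 2 :=
  AddMonoidHom.mk' (fun a => (M.enc a : ZMod 2)) fun a b => by
    rw [M.enc_add, ← ZMod.natCast_mod, Nat.xor_mod_two_eq, ZMod.natCast_mod, Nat.cast_add]

theorem lowBit_dec {u : ℕ} (hu : u < q) : M.lowBit (M.dec u) = (u : ZMod 2) := by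
  change ((M.enc (M.dec u) : ℕ) : ZMod 2) = u
  rw [M.enc_dec u hu]

theorem lowBit_one : M.lowBit 1 = 1 := by
  rw [← M.dec_one, M.lowBit_dec M.one_lt, Nat.cast_one]

theorem fieldPow_spec {u : ℕ} (i : ℕ) :
    fieldPow q h u i < q ∧ M.dec (fieldPow q h u i) = M.dec u ^ i := by
  induction i with
  | zero => exact ⟨M.one_lt, by simpa [fieldPow] using M.dec_one⟩
  | succ i ih =>
    refine ⟨M.mul_lt _ ih.1 u, ?_⟩
    change M.dec (fieldMul q h (fieldPow q h u i) u) = _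
    rw [M.dec_mul _ ih.1, ih.2, pow_succ]

end FieldModel

end FieldModel

/-! ### Counting over a finite field -/

section Counting

variable {K : Type} [CommRing K] [IsDomain K] [Fintype K] [DecidableEq K]

omit [DecidableEq K] in
/-- A nonzero functional is balanced on the multiples of a nonzero element. -/
theorem two_mul_card_functional_ne_zero (l : K →+ ZMod 2) (h1 : l 1 = 1) {c : K} (hc : c ≠ 0) :
    2 * (Finset.univ.filter fun y : K => l (y * c) ≠ 0).card = Fintype.card K := by
  have hinj : Function.Injective fun y : K => y * c := fun a b hab => mul_right_cancel₀ hc hab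
  obtain ⟨d, hd : d * c = 1⟩ := (Finite.injective_iff_surjective.1 hinj) 1
  -- translation by the inverse of `c` exchanges the two values of the functional
  have hswap : (Finset.univ.filter fun y : K => ¬ l (y * c) ≠ 0).card =
      (Finset.univ.filter fun y : K => l (y * c) ≠ 0).card := by
    refine Finset.card_bij' (fun y _ => y + d) (fun y _ => y - d) ?_ ?_ (by simp) (by simp)
    · intro y hy
      simp only [Finset.mem_filter, Finset.mem_univ, true_and, not_not] at hy ⊢
      rw [add_mul, map_add, hy, hd, h1]
      decide
    · intro y hy
      simp only [Finset.mem_filter, Finset.mem_univ, true_and, not_not] at hy ⊢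
      rw [sub_mul, map_sub, hd, h1]
      generalize l (y * c) = a at hy ⊢
      revert a
      decide
  have h := Finset.card_filter_add_card_filter_not (s := (Finset.univ : Finset K))
    fun y : K => l (y * c) ≠ 0
  rw [hswap, Finset.card_univ] at h
  omega

open Polynomial in
/-- A nonzero polynomial of degree less than `w`, with coefficients `0` and `1`, has fewer than `w`
roots. -/
theorem card_root_sum_lt (z : ℕ → ZMod 2) (w : ℕ) (hz : ∃ i < w, z i ≠ 0) :
    (Finset.univ.filter fun α : K =>
      (∑ i ∈ Finset.range w, if z i = 0 then 0 else α ^ i) = 0).card < w := by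
  obtain ⟨i, hi, hzi⟩ := hz
  set g : K[X] := ∑ i ∈ Finset.range w, if z i = 0 then 0 else X ^ i with hg
  have hcoeff : g.coeff i = 1 := by
    rw [hg, finsetSum_coeff, Finset.sum_eq_single i]
    · simp [hzi]
    · intro j _ hj
      split_ifs <;> simp [coeff_X_pow, hj.symm]
    · intro h; exact absurd (Finset.mem_range.2 hi) h
  have hg0 : g ≠ 0 := fun h => by rw [h] at hcoeff; simp at hcoeff
  have hdeg : g.natDegree < w := by
    rw [natDegree_lt_iff_degree_lt hg0]
    refine (degree_sum_le _ _).trans_lt ?_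
    rw [Finset.sup_lt_iff (by exact_mod_cast bot_lt_iff_ne_bot.2 (by simp))]
    intro j hj
    split_ifs
    · rw [degree_zero]; exact WithBot.bot_lt_coe w
    · rw [degree_X_pow]; exact_mod_cast Finset.mem_range.1 hj
  have heval : ∀ α : K, g.eval α = ∑ i ∈ Finset.range w, if z i = 0 then 0 else α ^ i := by
    intro α
    rw [hg, eval_finsetSum]
    refine Finset.sum_congr rfl fun j _ => ?_
    split_ifs <;> simp
  calc _ ≤ g.roots.toFinset.card := Finset.card_le_card fun α hα => by
        rw [Multiset.mem_toFinset, mem_roots hg0, IsRoot.def, heval]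
        exact (Finset.mem_filter.1 hα).2
    _ ≤ g.natDegree := (Multiset.toFinset_card_le _).trans (card_roots' g)
    _ < w := hdeg

/-- The distance of the code: the bits `l (y * g α)`, for a nonzero polynomial `g` of degree less
than `w`, are nonzero with probability at least `(1 - (w - 1) / q) / 2`. -/
theorem card_mul_le_two_mul_card_code (l : K →+ ZMod 2) (h1 : l 1 = 1) (z : ℕ → ZMod 2) {w : ℕ}
    (hz : ∃ i < w, z i ≠ 0) :
    (Fintype.card K + 1 - w) * Fintype.card K ≤ 2 * (Finset.univ.filter fun p : K × K =>
      l (p.2 * ∑ i ∈ Finset.range w, if z i = 0 then 0 else p.1 ^ i) ≠ 0).card := by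
  set g : K → K := fun α => ∑ i ∈ Finset.range w, if z i = 0 then 0 else α ^ i with hg
  set G : Finset K := Finset.univ.filter fun α => g α ≠ 0
  have hG : Fintype.card K + 1 - w ≤ G.card := by
    have h := card_root_sum_lt (K := K) z w hz
    have h' := Finset.card_filter_add_card_filter_not (s := (Finset.univ : Finset K))
      fun α => g α = 0
    rw [Finset.card_univ] at h'
    change _ + G.card = _ at h'
    change (Finset.univ.filter fun α : K => g α = 0).card < w at h
    have : 0 < w := hz.elim fun i hi => by omega
    omega
  have hsub : (G.sigma fun α => Finset.univ.filter fun y : K => l (y * g α) ≠ 0).card ≤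
      (Finset.univ.filter fun p : K × K => l (p.2 * g p.1) ≠ 0).card := by
    refine Finset.card_le_card_of_injOn (fun s => (s.1, s.2)) ?_ ?_
    · intro s hs
      have := (Finset.mem_sigma.1 hs).2
      simpa using this
    · rintro ⟨a, b⟩ _ ⟨c, d⟩ _ h
      cases h; rfl
  calc (Fintype.card K + 1 - w) * Fintype.card K ≤ G.card * Fintype.card K :=
        Nat.mul_le_mul_right _ hG
    _ = ∑ α ∈ G, 2 * (Finset.univ.filter fun y : K => l (y * g α) ≠ 0).card := by
        rw [Finset.sum_congr rfl fun α hα =>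
          two_mul_card_functional_ne_zero l h1 (Finset.mem_filter.1 hα).2, Finset.sum_const,
          smul_eq_mul]
    _ ≤ _ := by
        rw [← Finset.mul_sum, ← Finset.card_sigma]
        exact Nat.mul_le_mul_left 2 hsub

/-- The second moment bound: among the lines `i ↦ a + b * β i`, with `w` points each, at least the
fraction `w * s / (q + w * s)` meets a set `W` of size `s`. -/
theorem mul_sq_le_card_hit_mul (W : Finset K) (w : ℕ) (β : ℕ → K)
    (hβ : ∀ i < w, ∀ j < w, β i = β j → i = j) :
    w * W.card * Fintype.card K ^ 2 ≤
      (Finset.univ.filter fun p : K × K => ∃ i < w, p.1 + p.2 * β i ∈ W).card *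
        (Fintype.card K + w * W.card) := by
  set q := Fintype.card K
  set s := W.card
  set H := Finset.univ.filter fun p : K × K => ∃ i < w, p.1 + p.2 * β i ∈ W
  let Z : K × K → ℕ := fun p => ∑ i ∈ Finset.range w, if p.1 + p.2 * β i ∈ W then 1 else 0
  have hone : ∀ i, (∑ p : K × K, if p.1 + p.2 * β i ∈ W then 1 else 0) = s * q := by
    intro i
    rw [Finset.sum_boole, Nat.cast_id]
    refine Eq.trans ?_ (Finset.card_product W (Finset.univ : Finset K))
    refine Finset.card_bij' (fun p _ => (p.1 + p.2 * β i, p.2)) (fun p _ => (p.1 - p.2 * β i, p.2))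
      ?_ ?_ (by simp) (by simp)
    · intro p hp; simpa using hp
    · intro p hp; simpa using hp
  have htwo : ∀ i < w, ∀ j < w, i ≠ j → (∑ p : K × K,
      (if p.1 + p.2 * β i ∈ W then 1 else 0) * (if p.1 + p.2 * β j ∈ W then 1 else 0)) ≤
        s * s := by
    intro i hi j hj hij
    simp only [← ite_and, mul_ite, mul_one, mul_zero]
    rw [Finset.sum_boole, Nat.cast_id, ← Finset.card_product]
    refine Finset.card_le_card_of_injOn (fun p => (p.1 + p.2 * β i, p.1 + p.2 * β j)) ?_ ?_
    · intro p hp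
      have := (Finset.mem_filter.1 hp).2
      exact Finset.mem_coe.2 (Finset.mem_product.2 ⟨this.2, this.1⟩)
    · rintro ⟨a, b⟩ - ⟨a', b'⟩ - h
      obtain ⟨e1, e2⟩ := Prod.mk_inj.1 h
      simp only at e1 e2
      have hne : β i - β j ≠ 0 := fun h0 => hij (hβ i hi j hj (sub_eq_zero.1 h0))
      have hb : b = b' := mul_right_cancel₀ hne (by linear_combination e1 - e2)
      subst hb
      rw [add_right_cancel e1]
  have hsum : ∑ p ∈ H, Z p = w * s * q := by
    have : ∑ p ∈ H, Z p = ∑ p, Z p := by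
      refine Finset.sum_subset (Finset.subset_univ _) fun p _ hp => ?_
      refine Finset.sum_eq_zero fun i hi => if_neg fun h => hp ?_
      exact Finset.mem_filter.2 ⟨Finset.mem_univ _, i, Finset.mem_range.1 hi, h⟩
    rw [this, Finset.sum_comm, Finset.sum_congr rfl fun i _ => hone i]
    simp [mul_assoc]
  have hsq : ∑ p ∈ H, Z p ^ 2 ≤ w * s * (q + w * s) := by
    calc ∑ p ∈ H, Z p ^ 2 ≤ ∑ p, Z p ^ 2 :=
          Finset.sum_le_sum_of_subset (Finset.subset_univ _)
      _ = ∑ i ∈ Finset.range w, ∑ j ∈ Finset.range w, ∑ p : K × K,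
          (if p.1 + p.2 * β i ∈ W then 1 else 0) * (if p.1 + p.2 * β j ∈ W then 1 else 0) := by
          simp only [Z, sq, Finset.sum_mul_sum]
          rw [Finset.sum_comm]
          exact Finset.sum_congr rfl fun i _ => Finset.sum_comm
      _ ≤ ∑ i ∈ Finset.range w, ∑ j ∈ Finset.range w, ((if i = j then s * q else 0) + s * s) := by
          refine Finset.sum_le_sum fun i hi => Finset.sum_le_sum fun j hj => ?_
          by_cases hij : i = j
          · subst hij
            rw [if_pos rfl, ← hone i]
            refine le_add_right (Finset.sum_le_sum fun p _ => ?_)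
            split_ifs <;> simp
          · rw [if_neg hij, zero_add]
            exact htwo i (Finset.mem_range.1 hi) j (Finset.mem_range.1 hj) hij
      _ = w * s * (q + w * s) := by
          have : ∀ i ∈ Finset.range w, (∑ j ∈ Finset.range w,
              ((if i = j then s * q else 0) + s * s)) = s * q + w * (s * s) := by
            intro i hi
            rw [Finset.sum_add_distrib, Finset.sum_ite_eq, if_pos hi]
            simp
          rw [Finset.sum_congr rfl this]
          simp only [Finset.sum_const, Finset.card_range, smul_eq_mul]
          ring
  have hcs : (∑ p ∈ H, Z p) ^ 2 ≤ H.card * ∑ p ∈ H, Z p ^ 2 := by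
    exact_mod_cast sq_sum_le_card_mul_sum_sq (s := H) (f := Z)
  rw [hsum] at hcs
  rcases Nat.eq_zero_or_pos (w * s) with h0 | hpos
  · rw [h0, zero_mul]; exact Nat.zero_le _
  · have := hcs.trans (Nat.mul_le_mul_left _ hsq)
    refine Nat.le_of_mul_le_mul_left (c := w * s) ?_ hpos
    calc w * s * (w * s * q ^ 2) = (w * s * q) ^ 2 := by ring
      _ ≤ H.card * (w * s * (q + w * s)) := this
      _ = _ := by ring

end Counting

/-! ### The matrices -/

/-- The size of the field used for the matrices with `n` rows. -/
def fieldSize (c n : ℕ) : ℕ := leastPowGe (c * n)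

/-- The row to which the position `i` of the code is attached: the residue modulo `n` of the code
of the field element `a + b * i`, or `i` itself if the weight bound `w` is no restriction. -/
def rowIndex (q h w n a b i : ℕ) : ℕ := if n ≤ w then i else (a ^^^ fieldMul q h b i) % n

/-- The number of columns: pairs or quadruples of field elements. A matrix with one row has one
column, as the number of columns must not exceed `n ^ 7`. -/
def numCols (q w n : ℕ) : ℕ := if n = 1 then 1 else if n ≤ w then q ^ 2 else q ^ 4

/-- The entry of the matrix in row `j` and column `t`. The base `q` digits of `t` are field
elements `a, b, α, y`; the first two select rows, the last two the bits `y * α ^ i` of the code. -/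
def matrixEntry (q h w n j t : ℕ) : ℕ :=
  if n = 1 then 1 else (∑ i ∈ Finset.range (min w n),
    if rowIndex q h w n (t / q / q / q % q) (t / q / q % q) i = j then
      fieldMul q h (t % q) (fieldPow q h (t / q % q) i) % 2 else 0) % 2

/-- The matrix with weight bound `w` and with `n` rows, from the field of size `q` with modulus
`h`. -/
def designMatrix (q h w n : ℕ) : Matrix (Fin n) (Fin (numCols q w n)) (ZMod 2) :=
  fun j t => (matrixEntry q h w n j t : ZMod 2)

theorem columnWeight_designMatrix_le (q h w n : ℕ) (hw : 1 ≤ w) :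
    columnWeight (designMatrix q h w n) ≤ w := by
  refine Finset.sup_le fun t _ => ?_
  unfold hammingNorm
  by_cases hn : n = 1
  · subst hn
    exact (Finset.card_le_univ _).trans (by simpa using hw)
  let R : Finset ℕ := (Finset.range (min w n)).image
    (rowIndex q h w n (t / q / q / q % q) (t / q / q % q))
  calc _ ≤ R.card := by
        refine Finset.card_le_card_of_injOn Fin.val ?_ Fin.val_injective.injOn
        intro j hj
        have hj' := (Finset.mem_filter.1 hj).2
        by_contra hR
        refine hj' ?_
        simp only [designMatrix, matrixEntry, if_neg hn]
        rw [Finset.sum_eq_zero fun i hi => if_neg fun hij => hR (Finset.mem_coe.2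
          (Finset.mem_image.2 ⟨i, hi, hij⟩))]
        rfl
    _ ≤ min w n := Finset.card_image_le.trans (by simp)
    _ ≤ w := min_le_left _ _

/-- The function on `ℕ` that extends `x` by zero. -/
def extendZero {n : ℕ} (x : Fin n → ZMod 2) (j : ℕ) : ZMod 2 :=
  if hj : j < n then x ⟨j, hj⟩ else 0

variable {q h w n : ℕ}

/-- The entry `t` of `x D`: the bits `y * α ^ i` are added up over those positions `i` of the code
that are attached to a row in the support of `x`. -/
theorem vecMul_designMatrix (hn : 1 < n) (M : FieldModel q h) (x : Fin n → ZMod 2)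
    (t : Fin (numCols q w n)) :
    Matrix.vecMul x (designMatrix q h w n) t = M.lowBit (M.dec (t % q) *
      ∑ i ∈ Finset.range (min w n), if extendZero x (rowIndex q h w n (t / q / q / q % q)
        (t / q / q % q) i) = 0 then 0 else M.dec (t / q % q) ^ i) := by
  set ρ : ℕ → ℕ := rowIndex q h w n (t / q / q / q % q) (t / q / q % q)
  have hρ : ∀ i ∈ Finset.range (min w n), ρ i < n := by
    intro i hi
    have := Finset.mem_range.1 hi
    simp only [ρ, rowIndex]
    split_ifs
    · omega
    · exact Nat.mod_lt _ (by omega)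
  have hq : 0 < q := by have := M.one_lt; omega
  have hbit : ∀ i, ((fieldMul q h (t % q) (fieldPow q h (t / q % q) i) % 2 : ℕ) : ZMod 2) =
      M.lowBit (M.dec (t % q) * M.dec (t / q % q) ^ i) := by
    intro i
    have hp := M.fieldPow_spec (u := t / q % q) i
    have ht : (t : ℕ) % q < q := Nat.mod_lt _ hq
    rw [ZMod.natCast_mod, ← M.lowBit_dec (M.mul_lt _ ht _), M.dec_mul _ ht, hp.2]
  have hentry : ∀ j : Fin n, designMatrix q h w n j t = ∑ i ∈ Finset.range (min w n),
      if ρ i = j then M.lowBit (M.dec (t % q) * M.dec (t / q % q) ^ i) else 0 := by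
    intro j
    simp only [designMatrix, matrixEntry, if_neg hn.ne']
    rw [ZMod.natCast_mod, Nat.cast_sum]
    refine Finset.sum_congr rfl fun i _ => ?_
    rw [← hbit]
    change ((if ρ i = j then _ else 0 : ℕ) : ZMod 2) = _
    split_ifs <;> simp
  rw [Finset.mul_sum, map_sum]
  simp only [Matrix.vecMul, dotProduct, hentry, Finset.mul_sum]
  rw [Finset.sum_comm]
  refine Finset.sum_congr rfl fun i hi => ?_
  rw [Finset.sum_eq_single (⟨ρ i, hρ i hi⟩ : Fin n)]
  · rw [if_pos rfl, extendZero, dif_pos (hρ i hi)]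
    have hx2 : ∀ a : ZMod 2, a = 0 ∨ a = 1 := by decide
    rcases hx2 (x ⟨ρ i, hρ i hi⟩) with h0 | h0
    · rw [h0, if_pos rfl, mul_zero, map_zero, zero_mul]
    · rw [h0, if_neg one_ne_zero, one_mul]
  · intro j _ hj
    rw [if_neg fun h => hj (Fin.ext h.symm), mul_zero]
  · intro h; exact absurd (Finset.mem_univ _) h

theorem mod_div_mul_add (u : ℕ) {v : ℕ} (hv : v < q) :
    (u * q + v) % q = v ∧ (u * q + v) / q = u := by
  constructor
  · rw [mul_comm, Nat.mul_add_mod, Nat.mod_eq_of_lt hv]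
  · rw [mul_comm, Nat.mul_add_div (by omega), Nat.div_eq_of_lt hv, Nat.add_zero]

/-- The columns of the matrix that detect `x`. -/
def detecting (q h w : ℕ) {n : ℕ} (x : Fin n → ZMod 2) : Finset (Fin (numCols q w n)) :=
  Finset.univ.filter fun t => Matrix.vecMul x (designMatrix q h w n) t ≠ 0

/-- If the weight bound is no restriction, then the columns form a code of distance almost
`1 / 2`. -/
theorem card_detecting_of_le (hn : 1 < n) (hw : n ≤ w) (M : FieldModel q h) {x : Fin n → ZMod 2}
    (hx : x ≠ 0) : (q + 1 - n) * q ≤ 2 * (detecting q h w x).card := by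
  classical
  have hcols : numCols q w n = q ^ 2 := by rw [numCols, if_neg hn.ne', if_pos hw]
  obtain ⟨j, hj⟩ := Function.ne_iff.1 hx
  have hz : ∃ i < n, extendZero x i ≠ 0 := ⟨j, j.2, by rwa [extendZero, dif_pos j.2]⟩
  have hcode := card_mul_le_two_mul_card_code M.lowBit M.lowBit_one (extendZero x) hz
  rw [M.card_eq] at hcode
  refine hcode.trans (Nat.mul_le_mul_left 2 ?_)
  have hlt : ∀ p : M.K × M.K, M.enc p.1 * q + M.enc p.2 < numCols q w n := by
    intro p
    rw [hcols]
    have h1 := M.enc_lt p.1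
    have h2 := M.enc_lt p.2
    nlinarith
  refine Finset.card_le_card_of_injOn (fun p => ⟨M.enc p.1 * q + M.enc p.2, hlt p⟩) ?_ ?_
  · intro p hp
    have hp' := (Finset.mem_filter.1 hp).2
    refine Finset.mem_coe.2 (Finset.mem_filter.2 ⟨Finset.mem_univ _, ?_⟩)
    rw [vecMul_designMatrix hn M]
    simp only [rowIndex, if_pos hw, min_eq_right hw]
    rw [(mod_div_mul_add _ (M.enc_lt p.2)).1, (mod_div_mul_add _ (M.enc_lt p.2)).2,
      Nat.mod_eq_of_lt (M.enc_lt _), M.dec_enc, M.dec_enc]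
    exact hp'
  · rintro p - p' - hpp
    have hpp' := Fin.mk.inj_iff.1 hpp
    have e1 := congrArg (· % q) hpp'
    have e2 := congrArg (· / q) hpp'
    simp only [(mod_div_mul_add _ (M.enc_lt _)).1] at e1
    simp only [(mod_div_mul_add _ (M.enc_lt _)).2] at e2
    exact Prod.ext (M.enc_injective e2) (M.enc_injective e1)

/-- The columns that detect `x`, for a restricted weight bound: `s` is the number of field elements
attached to a row in the support of `x`, and `H` is the number of lines that contain one of them;
each such line selects a nonzero pattern, which the code detects. -/
theorem card_detecting_of_lt (hn : 1 < n) (hw : w < n) (hnq : n ≤ q) (M : FieldModel q h)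
    (x : Fin n → ZMod 2) : ∃ s H, hammingNorm x * (q / n) ≤ s ∧
      w * s * q ^ 2 ≤ H * (q + w * s) ∧
      H * ((q + 1 - w) * q) ≤ 2 * (detecting q h w x).card := by
  classical
  have hcols : numCols q w n = q ^ 4 := by rw [numCols, if_neg hn.ne', if_neg (by omega)]
  let W : Finset M.K := Finset.univ.filter fun a => extendZero x (M.enc a % n) ≠ 0
  let Hit : Finset (M.K × M.K) :=
    Finset.univ.filter fun p => ∃ i < w, p.1 + p.2 * M.dec i ∈ W
  have hq : 0 < q := by omega
  refine ⟨W.card, Hit.card, ?_, ?_, ?_⟩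
  · unfold hammingNorm
    rw [← Finset.card_range (q / n), ← Finset.card_product]
    have hlt : ∀ p : Fin n × ℕ, p.2 < q / n → n * p.2 + p.1 < q := by
      intro p hp
      have h1 : n * (p.2 + 1) ≤ n * (q / n) := Nat.mul_le_mul_left _ hp
      have h2 := Nat.mul_div_le q n
      have h3 := p.1.2
      rw [Nat.mul_succ] at h1
      omega
    refine Finset.card_le_card_of_injOn (fun p => M.dec (n * p.2 + p.1)) ?_ ?_
    · intro p hp
      obtain ⟨hp1, hp2⟩ := Finset.mem_product.1 hp
      refine Finset.mem_coe.2 (Finset.mem_filter.2 ⟨Finset.mem_univ _, ?_⟩)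
      rw [M.enc_dec _ (hlt p (Finset.mem_range.1 hp2)), Nat.mul_add_mod,
        Nat.mod_eq_of_lt p.1.2, extendZero, dif_pos p.1.2]
      exact (Finset.mem_filter.1 hp1).2
    · intro p hp p' hp' hpp
      have l1 := hlt p (Finset.mem_range.1 (Finset.mem_product.1 hp).2)
      have l2 := hlt p' (Finset.mem_range.1 (Finset.mem_product.1 hp').2)
      have e := M.dec_injOn l1 l2 hpp
      have e1 := congrArg (· % n) e
      have e2 := congrArg (· / n) e
      simp only [Nat.mul_add_mod, Nat.mod_eq_of_lt p.1.2, Nat.mod_eq_of_lt p'.1.2] at e1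
      simp only [Nat.mul_add_div (show 0 < n by omega), Nat.div_eq_of_lt p.1.2,
        Nat.div_eq_of_lt p'.1.2, Nat.add_zero] at e2
      exact Prod.ext (Fin.ext e1) e2
  · have := mul_sq_le_card_hit_mul W w M.dec fun i hi j hj hij =>
      M.dec_injOn (by omega) (by omega) hij
    rwa [M.card_eq] at this
  · -- the pattern selected by the line `i ↦ a + b * i`
    let z : M.K × M.K → ℕ → ZMod 2 := fun p i => extendZero x (M.enc (p.1 + p.2 * M.dec i) % n)
    let good : M.K × M.K → Finset (M.K × M.K) := fun p => Finset.univ.filter fun r =>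
      M.lowBit (r.2 * ∑ i ∈ Finset.range w, if z p i = 0 then 0 else r.1 ^ i) ≠ 0
    have hgood : ∀ p ∈ Hit, (q + 1 - w) * q ≤ 2 * (good p).card := by
      intro p hp
      obtain ⟨i, hi, hW⟩ := (Finset.mem_filter.1 hp).2
      have hcode := card_mul_le_two_mul_card_code M.lowBit M.lowBit_one (z p)
        ⟨i, hi, (Finset.mem_filter.1 hW).2⟩
      rwa [M.card_eq] at hcode
    have hlt4 : ∀ a b c d : ℕ, a < q → b < q → c < q → d < q →
        ((a * q + b) * q + c) * q + d < numCols q w n := by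
      have step : ∀ N u v : ℕ, u < N → v < q → u * q + v < N * q := by
        intro N u v hu hv
        have : (u + 1) * q ≤ N * q := Nat.mul_le_mul_right _ hu
        rw [Nat.succ_mul] at this
        omega
      intro a b c d ha hb hc hd
      rw [hcols, show q ^ 4 = q * q * q * q by ring]
      exact step _ _ _ (step _ _ _ (step _ _ _ ha hb) hc) hd
    have hsub : (Hit.sigma good).card ≤ (detecting q h w x).card := by
      refine Finset.card_le_card_of_injOn (fun s =>
        ⟨((M.enc s.1.1 * q + M.enc s.1.2) * q + M.enc s.2.1) * q + M.enc s.2.2,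
          hlt4 _ _ _ _ (M.enc_lt _) (M.enc_lt _) (M.enc_lt _) (M.enc_lt _)⟩) ?_ ?_
      · intro s hs
        have hs' := (Finset.mem_filter.1 (Finset.mem_sigma.1 hs).2).2
        refine Finset.mem_coe.2 (Finset.mem_filter.2 ⟨Finset.mem_univ _, ?_⟩)
        rw [vecMul_designMatrix hn M]
        simp only [(mod_div_mul_add _ (M.enc_lt _)).1, (mod_div_mul_add _ (M.enc_lt _)).2, M.dec_enc,
          Nat.mod_eq_of_lt (M.enc_lt s.1.1), min_eq_left hw.le, rowIndex, if_neg (not_le.2 hw)]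
        have hrow : ∀ i, M.enc s.1.1 ^^^ fieldMul q h (M.enc s.1.2) i =
            M.enc (s.1.1 + s.1.2 * M.dec i) := by
          intro i
          rw [← M.enc_dec _ (M.xor_lt _ (M.enc_lt s.1.1) _ (M.mul_lt _ (M.enc_lt s.1.2) i)),
            M.dec_xor, M.dec_mul _ (M.enc_lt _), M.dec_enc, M.dec_enc]
        simp only [hrow]
        exact hs'
      · rintro ⟨⟨a, b⟩, c, d⟩ - ⟨⟨a', b'⟩, c', d'⟩ - hss
        have e := Fin.mk.inj_iff.1 hss
        simp only at e
        have e1 := congrArg (· % q) e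
        have f1 := congrArg (· / q) e
        simp only [(mod_div_mul_add _ (M.enc_lt _)).1] at e1
        simp only [(mod_div_mul_add _ (M.enc_lt _)).2] at f1
        have e2 := congrArg (· % q) f1
        have f2 := congrArg (· / q) f1
        simp only [(mod_div_mul_add _ (M.enc_lt _)).1] at e2
        simp only [(mod_div_mul_add _ (M.enc_lt _)).2] at f2
        have e3 := congrArg (· % q) f2
        have f3 := congrArg (· / q) f2
        simp only [(mod_div_mul_add _ (M.enc_lt _)).1] at e3
        simp only [(mod_div_mul_add _ (M.enc_lt _)).2] at f3
        rw [M.enc_injective e1, M.enc_injective e2, M.enc_injective e3, M.enc_injective f3]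
    calc Hit.card * ((q + 1 - w) * q) = ∑ _p ∈ Hit, (q + 1 - w) * q := by
          rw [Finset.sum_const, smul_eq_mul]
      _ ≤ ∑ p ∈ Hit, 2 * (good p).card := Finset.sum_le_sum hgood
      _ = 2 * (Hit.sigma good).card := by rw [Finset.card_sigma, Finset.mul_sum]
      _ ≤ _ := Nat.mul_le_mul_left 2 hsub

/-! ### The distinguishing property -/

theorem isDistinguisher_designMatrix {ε δ : ℝ} (hδ : ∀ x : Fin n → ZMod 2,
    ε * n ≤ hammingNorm x → δ * (numCols q w n : ℕ) ≤ (detecting q h w x).card) :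
    IsDistinguisher (designMatrix q h w n) ε δ := by
  intro x y hxy
  rw [hammingDist_eq_hammingNorm] at hxy
  rw [hammingDist_eq_hammingNorm]
  refine (hδ _ hxy).trans (le_of_eq ?_)
  rw [detecting, hammingNorm]
  congr 2
  ext t
  rw [Finset.mem_filter, Finset.mem_filter, Matrix.add_vecMul, Matrix.neg_vecMul]

theorem fieldSize_spec {c n : ℕ} (hc : 2 ≤ c) (hn : 1 ≤ n) :
    c * n ≤ fieldSize c n ∧ fieldSize c n < 2 * (c * n) ∧
      Nonempty (FieldModel (fieldSize c n) (fieldModulus (fieldSize c n))) := by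
  obtain ⟨r, h1, h2, h3⟩ := exists_leastPowGe_eq (c * n)
  have h1' : fieldSize c n = 2 ^ r := h1
  have hcn : 2 ≤ c * n := Nat.mul_le_mul hc hn
  have hr : r ≠ 0 := by
    rintro rfl
    simp at h2
    omega
  rw [h1']
  exact ⟨h2, h3.resolve_left hr, exists_fieldModel hr⟩

/-- The matrix with a weight bound that is no restriction detects every nonzero vector in a
quarter of the columns. -/
theorem numCols_le_four_mul_card_detecting {c : ℕ} (hc : 2 ≤ c) (hn : 1 < n) (hw : n ≤ w)
    {x : Fin n → ZMod 2} (hx : x ≠ 0) :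
    numCols (fieldSize c n) w n ≤
      4 * (detecting (fieldSize c n) (fieldModulus (fieldSize c n)) w x).card := by
  obtain ⟨h1, -, ⟨M⟩⟩ := fieldSize_spec hc hn.le
  have := card_detecting_of_le hn hw M hx
  set q := fieldSize c n
  have hq : 2 * n ≤ q := (Nat.mul_le_mul_right n hc).trans h1
  have h2 : q ≤ 2 * (q + 1 - n) := by omega
  set d := (detecting q (fieldModulus q) w x).card
  rw [numCols, if_neg hn.ne', if_pos hw]
  nlinarith

/-- The estimate for a restricted weight bound, as an inequality of reals; `μ` is the expected
number of hits, up to rounding, and `c / (c + 1)` accounts for the rounding. -/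
theorem le_card_detecting_of_lt {c : ℕ} (hc : 2 ≤ c) (hn : 1 < n) (hw : w < n)
    (x : Fin n → ZMod 2) {μ : ℝ} (hμ : μ * n = w * hammingNorm x) (hμ0 : 0 ≤ μ) :
    (1 - 1 / c) / 2 * (c * μ / (c + 1 + c * μ)) * (numCols (fieldSize c n) w n : ℕ) ≤
      ((detecting (fieldSize c n) (fieldModulus (fieldSize c n)) w x).card : ℝ) := by
  obtain ⟨h1, -, ⟨M⟩⟩ := fieldSize_spec hc hn.le
  set q := fieldSize c n
  have hnq : n ≤ q := (Nat.le_mul_of_pos_left n (by omega)).trans h1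
  obtain ⟨s, H, hs, hH, hd⟩ := card_detecting_of_lt hn hw hnq M x
  set d := (detecting q (fieldModulus q) w x).card
  set k := hammingNorm x
  rw [numCols, if_neg hn.ne', if_neg (by omega), Nat.cast_pow]
  have hc0 : (0 : ℝ) < c := by exact_mod_cast (by omega : 0 < c)
  have hn0 : (0 : ℝ) < n := by exact_mod_cast (by omega : 0 < n)
  have hq0 : (0 : ℝ) < q := by exact_mod_cast (by omega : 0 < q)
  -- rounding `q / n` loses at most the factor `c / (c + 1)`
  have hfloor : (c : ℝ) * q ≤ (c + 1) * (n * (q / n : ℕ)) := by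
    have hf : c ≤ q / n := (Nat.le_div_iff_mul_le (by omega)).2 h1
    have hlt : q < n * (q / n) + n := by
      have := Nat.div_add_mod q n
      have := Nat.mod_lt q (show n > 0 by omega)
      omega
    have hcn : c * n ≤ n * (q / n) := by rw [mul_comm]; exact Nat.mul_le_mul_left _ hf
    have : c * q ≤ (c + 1) * (n * (q / n)) := by nlinarith
    exact_mod_cast this
  have hsr : (k : ℝ) * (q / n : ℕ) ≤ s := by exact_mod_cast hs
  -- the expected number of hits
  have hws : c * μ / (c + 1) * q ≤ w * s := by
    rw [div_mul_eq_mul_div, div_le_iff₀ (by positivity)]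
    have e1 : (w : ℝ) * k * (q / n : ℕ) ≤ w * s := by
      rw [mul_assoc]; exact mul_le_mul_of_nonneg_left hsr (Nat.cast_nonneg _)
    rw [← hμ] at e1
    calc c * μ * q = μ * (c * q) := by ring
      _ ≤ μ * ((c + 1) * (n * (q / n : ℕ))) := mul_le_mul_of_nonneg_left hfloor hμ0
      _ = μ * n * (q / n : ℕ) * (c + 1) := by ring
      _ ≤ w * s * (c + 1) := mul_le_mul_of_nonneg_right e1 (by positivity)
  have hHr : (w : ℝ) * s * q ^ 2 ≤ H * (q + w * s) := by exact_mod_cast hH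
  have hhit : c * μ / (c + 1 + c * μ) * q ^ 2 ≤ H := by
    have hpos : (0 : ℝ) < q + w * s := by positivity
    rw [← div_le_iff₀ hpos] at hHr
    refine le_trans ?_ hHr
    rw [mul_div_right_comm ((w : ℝ) * s) ((q : ℝ) ^ 2)]
    refine mul_le_mul_of_nonneg_right ?_ (sq_nonneg _)
    rw [div_le_div_iff₀ (by positivity) hpos]
    rw [div_mul_eq_mul_div, div_le_iff₀ (by positivity)] at hws
    nlinarith
  have hcode : (1 - 1 / c) * (q : ℝ) ≤ (q + 1 - w : ℕ) := by
    rw [Nat.cast_sub (by omega)]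
    have e1 : (c : ℝ) * n ≤ q := by exact_mod_cast h1
    have e2 : (w : ℝ) ≤ n := by exact_mod_cast hw.le
    have e3 : (n : ℝ) ≤ 1 / c * q := by rw [one_div_mul_eq_div, le_div_iff₀ hc0]; linarith
    push_cast
    linarith
  have hdr : (H : ℝ) * ((q + 1 - w : ℕ) * q) ≤ 2 * d := by exact_mod_cast hd
  have hc1 : (0 : ℝ) ≤ 1 - 1 / c := by
    rw [sub_nonneg, div_le_one hc0]; exact_mod_cast (by omega : 1 ≤ c)
  have hcode' : (1 - 1 / c) * (q : ℝ) * q ≤ (q + 1 - w : ℕ) * (q : ℝ) :=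
    mul_le_mul_of_nonneg_right hcode hq0.le
  have := mul_le_mul hhit hcode' (mul_nonneg (mul_nonneg hc1 hq0.le) hq0.le) (Nat.cast_nonneg H)
  linarith

/-- With `c = 4`, the fraction of detecting columns is at least
`(3 / 8) * (4 μ / (5 + 4 μ)) ≥ (1 - 1 / μ) / 4`, where `μ ≥ ε w`. -/
theorem isDistinguisher_of_le_quarter {ε δ : ℝ} (hε : 0 < ε) (hw : 1 ≤ w)
    (hn : 1 < n) (h : δ ≤ (1 - 1 / (ε * w)) / 4) :
    IsDistinguisher (designMatrix (fieldSize 4 n) (fieldModulus (fieldSize 4 n)) w n) ε δ := by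
  refine isDistinguisher_designMatrix fun x hx => ?_
  have hn0 : (0 : ℝ) < n := by exact_mod_cast (by omega : 0 < n)
  have hw0 : (0 : ℝ) < w := by exact_mod_cast hw
  have hk0 : (0 : ℝ) < hammingNorm x := (mul_pos hε hn0).trans_le hx
  rcases le_or_gt n w with hnw | hwn
  · have hx0 : x ≠ 0 := by
      rintro rfl
      rw [hammingNorm_zero, Nat.cast_zero] at hk0
      exact lt_irrefl _ hk0
    have h4 : ((numCols (fieldSize 4 n) w n : ℕ) : ℝ) ≤
        4 * (detecting (fieldSize 4 n) (fieldModulus (fieldSize 4 n)) w x).card := by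
      exact_mod_cast numCols_le_four_mul_card_detecting (by norm_num) hn hnw hx0
    have hδ4 : δ ≤ 1 / 4 := by
      have : 0 < 1 / (ε * w) := by positivity
      linarith
    have := mul_le_mul_of_nonneg_right hδ4 (Nat.cast_nonneg (α := ℝ) (numCols (fieldSize 4 n) w n))
    linarith
  · set μ : ℝ := w * hammingNorm x / n with hμ
    have hμ0 : 0 < μ := by positivity
    have key := le_card_detecting_of_lt (c := 4) (by norm_num) hn hwn x (μ := μ)
      (div_mul_cancel₀ _ hn0.ne') hμ0.le
    refine le_trans (mul_le_mul_of_nonneg_right ?_ (Nat.cast_nonneg _)) key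
    have h1 : ε * w ≤ μ := by
      rw [hμ, le_div_iff₀ hn0]
      nlinarith
    have h2 : 1 / μ ≤ 1 / (ε * w) := one_div_le_one_div_of_le (by positivity) h1
    have h3 : (1 - 1 / μ) / 4 ≤ (1 - 1 / 4) / 2 * (4 * μ / (4 + 1 + 4 * μ)) := by
      have e : (1 - 1 / 4) / 2 * (4 * μ / (4 + 1 + 4 * μ)) - (1 - 1 / μ) / 4 =
          (2 * μ ^ 2 - μ + 5) / (4 * μ * (5 + 4 * μ)) := by
        field_simp
        ring
      have : 0 ≤ (2 * μ ^ 2 - μ + 5) / (4 * μ * (5 + 4 * μ)) :=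
        div_nonneg (by nlinarith [sq_nonneg (μ - 1)]) (by positivity)
      linarith
    push_cast
    linarith

/-- With `c = 2`, the fraction of detecting columns is at least
`(1 / 4) * (2 μ / (3 + 2 μ)) ≥ 1 / 8`, where `μ ≥ ε w ≥ 2`. -/
theorem isDistinguisher_eighth {ε : ℝ} (hw : 1 ≤ w) (hn : 1 < n) (hε : 0 < ε)
    (h : 2 ≤ ε * w) :
    IsDistinguisher (designMatrix (fieldSize 2 n) (fieldModulus (fieldSize 2 n)) w n) ε
      (1 / 8) := by
  refine isDistinguisher_designMatrix fun x hx => ?_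
  have hn0 : (0 : ℝ) < n := by exact_mod_cast (by omega : 0 < n)
  have hw0 : (0 : ℝ) < w := by exact_mod_cast hw
  have hk0 : (0 : ℝ) < hammingNorm x := (mul_pos hε hn0).trans_le hx
  rcases le_or_gt n w with hnw | hwn
  · have hx0 : x ≠ 0 := by
      rintro rfl
      rw [hammingNorm_zero, Nat.cast_zero] at hk0
      exact lt_irrefl _ hk0
    have h4 : ((numCols (fieldSize 2 n) w n : ℕ) : ℝ) ≤
        4 * (detecting (fieldSize 2 n) (fieldModulus (fieldSize 2 n)) w x).card := by
      exact_mod_cast numCols_le_four_mul_card_detecting le_rfl hn hnw hx0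
    have := Nat.cast_nonneg (α := ℝ) (numCols (fieldSize 2 n) w n)
    linarith
  · set μ : ℝ := w * hammingNorm x / n with hμ
    have hμ0 : 0 < μ := by positivity
    have key := le_card_detecting_of_lt (c := 2) le_rfl hn hwn x (μ := μ)
      (div_mul_cancel₀ _ hn0.ne') hμ0.le
    refine le_trans (mul_le_mul_of_nonneg_right ?_ (Nat.cast_nonneg _)) key
    have h1 : 2 ≤ μ := by
      rw [hμ, le_div_iff₀ hn0]
      nlinarith
    have h2 : (1 / 2 : ℝ) ≤ 2 * μ / (2 + 1 + 2 * μ) := by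
      rw [div_le_div_iff₀ (by norm_num) (by positivity)]
      linarith
    push_cast
    linarith

theorem numCols_pos {c : ℕ} (hc : 2 ≤ c) (hn : 1 ≤ n) : 1 ≤ numCols (fieldSize c n) w n := by
  obtain ⟨h1, -, -⟩ := fieldSize_spec hc hn
  have : 0 < fieldSize c n := (Nat.mul_pos (by omega) hn).trans_le h1
  unfold numCols
  split_ifs
  · exact le_rfl
  · exact Nat.pow_pos this
  · exact Nat.pow_pos this

theorem numCols_four_le (hn : 16 ≤ n) : numCols (fieldSize 4 n) w n ≤ n ^ 7 := by
  obtain ⟨h1, h2, -⟩ := fieldSize_spec (c := 4) (n := n) (by norm_num) (by omega)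
  have h3 : fieldSize 4 n ^ 4 ≤ n ^ 7 := by
    calc fieldSize 4 n ^ 4 ≤ (8 * n) ^ 4 := Nat.pow_le_pow_left (by omega) 4
      _ = 16 ^ 3 * n ^ 4 := by ring
      _ ≤ n ^ 3 * n ^ 4 := Nat.mul_le_mul_right _ (Nat.pow_le_pow_left hn 3)
      _ = n ^ 7 := by ring
  unfold numCols
  split_ifs
  · exact Nat.one_le_pow _ _ (by omega)
  · exact (Nat.pow_le_pow_right (by omega) (by norm_num)).trans h3
  · exact h3

theorem numCols_two_le (hn : 1 ≤ n) (hw : w < n → 4 ≤ n) :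
    numCols (fieldSize 2 n) w n ≤ n ^ 7 := by
  obtain ⟨h1, h2, -⟩ := fieldSize_spec (c := 2) le_rfl hn
  have h2' : fieldSize 2 n ≤ 4 * n := by omega
  unfold numCols
  split_ifs with e1 e2
  · exact Nat.one_le_pow _ _ hn
  · have hn2 : 2 ≤ n := by omega
    calc fieldSize 2 n ^ 2 ≤ (4 * n) ^ 2 := Nat.pow_le_pow_left h2' 2
      _ = 2 ^ 4 * n ^ 2 := by ring
      _ ≤ n ^ 5 * n ^ 2 := Nat.mul_le_mul_right _ ((Nat.pow_le_pow_left hn2 4).trans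
          (Nat.pow_le_pow_right hn (by norm_num)))
      _ = n ^ 7 := by ring
  · have hn4 := hw (by omega)
    rcases le_or_gt 7 n with h7 | h7
    · calc fieldSize 2 n ^ 4 ≤ (4 * n) ^ 4 := Nat.pow_le_pow_left h2' 4
        _ = 256 * n ^ 4 := by ring
        _ ≤ n ^ 3 * n ^ 4 := Nat.mul_le_mul_right _ ((by norm_num : 256 ≤ 7 ^ 3).trans
            (Nat.pow_le_pow_left h7 3))
        _ = n ^ 7 := by ring
    · interval_cases n <;> decide

/-! ### The matrices are computed by counter programs -/

namespace CounterPoly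

open CounterDecidable

variable {k : ℕ} {q h w n f g a b : (Fin k → ℕ) → ℕ}

theorem min (hf : CounterPoly f) (hg : CounterPoly g) : CounterPoly fun v => min (f v) (g v) :=
  (ite (le hf hg) hf hg).congr fun v => by rw [min_def]

theorem fieldSize (c : ℕ) (hn : CounterPoly n) : CounterPoly fun v => fieldSize c (n v) :=
  leastPowGe ((const c).mul hn)

theorem numCols (hq : CounterPoly q) (hw : CounterPoly w) (hn : CounterPoly n) :
    CounterPoly fun v => numCols (q v) (w v) (n v) :=
  ite (eq hn one) one (ite (le hn hw) (hq.pow 2) (hq.pow 4))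

theorem rowIndex {i : (Fin k → ℕ) → ℕ} (hq : CounterPoly q) (hh : CounterPoly h)
    (hw : CounterPoly w) (hn : CounterPoly n) (ha : CounterPoly a) (hb : CounterPoly b)
    (hi : CounterPoly i) :
    CounterPoly fun v => rowIndex (q v) (h v) (w v) (n v) (a v) (b v) (i v) :=
  ite (le hn hw) hi ((ha.xor (fieldMul hq hh hb hi)).mod hn)

theorem matrixEntry {j t : (Fin k → ℕ) → ℕ} (hq : CounterPoly q) (hh : CounterPoly h)
    (hw : CounterPoly w) (hn : CounterPoly n) (hj : CounterPoly j) (ht : CounterPoly t) :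
    CounterPoly fun v => matrixEntry (q v) (h v) (w v) (n v) (j v) (t v) := by
  have h1 := ht.div hq
  have h2 := h1.div hq
  have hrow := eq (rowIndex hq.weaken hh.weaken hw.weaken hn.weaken ((h2.div hq).mod hq).weaken
    (h2.mod hq).weaken (proj 0)) hj.weaken
  have hbit := (fieldMul hq.weaken hh.weaken (ht.mod hq).weaken
    (fieldPow hq.weaken hh.weaken (h1.mod hq).weaken (proj 0))).mod (const 2)
  exact ite (eq hn one) one ((sum (f := fun v i =>
    if _root_.rowIndex (q v) (h v) (w v) (n v) (t v / q v / q v / q v % q v)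
      (t v / q v / q v % q v) i = j v then
      _root_.fieldMul (q v) (h v) (t v % q v)
        (_root_.fieldPow (q v) (h v) (t v / q v % q v) i) % 2 else 0)
    (ite hrow hbit zero) (hw.min hn)).mod (const 2))

/-- For `ε = a / b`, the value is the number of `t` with `t ^ b < 2 ^ b * n ^ a`. -/
theorem ceil_two_mul_rpow {ε : ℚ} (h0 : 0 < ε) (h1 : ε ≤ 1) :
    CounterPoly fun v : Fin 1 → ℕ => ⌈2 * ((v 0 : ℕ) : ℝ) ^ (ε : ℝ)⌉₊ := by
  refine (sum (f := fun v t => if t ^ ε.den < 2 ^ ε.den * v 0 ^ ε.num.toNat then 1 else 0)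
    (ite (lt ((proj 0).pow ε.den) ((const (2 ^ ε.den)).mul ((proj 1).pow ε.num.toNat))) one zero)
    ((const 2).mul (proj 0))).congr fun v => ?_
  generalize v 0 = n
  have hε : (0 : ℝ) < ε := by exact_mod_cast h0
  rcases Nat.eq_zero_or_pos n with rfl | hn
  · simp [Real.zero_rpow hε.ne']
  rw [Finset.sum_boole, Nat.cast_id]
  have hn1 : (1 : ℝ) ≤ n := by exact_mod_cast hn
  have hpow : ((n : ℝ) ^ (ε : ℝ)) ^ ε.den = (n : ℝ) ^ ε.num.toNat := by
    rw [← Real.rpow_natCast, ← Real.rpow_mul (by positivity), ← Real.rpow_natCast]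
    congr 1
    have hnum : ((ε.num.toNat : ℤ) : ℚ) = ε.num := by
      rw [Int.toNat_of_nonneg (Rat.num_nonneg.2 h0.le)]
    have : ε * ε.den = (ε.num.toNat : ℕ) := by
      rw [Rat.mul_den_eq_num, ← hnum, Int.cast_natCast]
    exact_mod_cast congrArg (fun x : ℚ => (x : ℝ)) this
  have hle : (n : ℝ) ^ (ε : ℝ) ≤ n := by
    conv_rhs => rw [← Real.rpow_one (n : ℝ)]
    exact Real.rpow_le_rpow_of_exponent_le hn1 (by exact_mod_cast h1)
  have hiff : ∀ t : ℕ, t ^ ε.den < 2 ^ ε.den * n ^ ε.num.toNat ↔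
      t < ⌈2 * (n : ℝ) ^ (ε : ℝ)⌉₊ := by
    intro t
    rw [Nat.lt_ceil, ← pow_lt_pow_iff_left₀ (Nat.cast_nonneg t)
      (by positivity : (0 : ℝ) ≤ 2 * (n : ℝ) ^ (ε : ℝ)) ε.den_ne_zero,
      mul_pow, hpow]
    norm_cast
  have : {t ∈ Finset.range (2 * n) | t ^ ε.den < 2 ^ ε.den * n ^ ε.num.toNat} =
      Finset.range ⌈2 * (n : ℝ) ^ (ε : ℝ)⌉₊ := by
    ext t
    rw [Finset.mem_filter, Finset.mem_range, Finset.mem_range, hiff]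
    refine ⟨fun h => h.2, fun h => ⟨h.trans_le (Nat.ceil_le.2 ?_), h⟩⟩
    push_cast
    linarith
  rw [this, Finset.card_range]

end CounterPoly

theorem matrixEntry_le_one (q h w n j t : ℕ) : matrixEntry q h w n j t ≤ 1 := by
  unfold matrixEntry
  split_ifs
  · exact le_rfl
  · omega

/-! ### Input, output and subroutines -/

namespace RegFrag

open Polynomial

variable {R X : Type} [DecidableEq R] [DecidableEq X] {A : X → Type} {σ : Type}

/-- Pop symbols from the further stack `i` as long as they satisfy `p`, counting them in `r`. -/
def drain (i : X) (p : A i → Bool) (r : R) : RegFrag R A σ :=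
  Frag.loopWhile (Γ := RegAlphabet R A) (.inr i) p (inc r)

/-- After the symbols `l` have been popped, the loop goes on as if started with the rest. -/
theorem drain_round (i : X) (p : A i → Bool) (r : R) {l rest : List (A i)}
    (hl : ∀ a ∈ l, p a = true) (c : R → ℕ) (x : ∀ i, List (A i)) (hx : x i = l ++ rest)
    {S' : ∀ k, List (RegAlphabet R A k)} {t : ℕ}
    (hend : (drain i p r : RegFrag R A σ).Runs (regState (Function.update c r (c r + l.length))
      (Function.update x i rest)) S' t) :
    (drain i p r : RegFrag R A σ).Runs (regState c x) S' (l.length * 2 + t) := by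
  induction l generalizing c x with
  | nil =>
    have h1 : Function.update x i rest = x := by
      rw [show rest = x i from hx.symm, Function.update_eq_self]
    rw [h1, List.length_nil, Nat.add_zero, Function.update_eq_self] at hend
    simpa using hend
  | cons a l ih =>
    have h1 := inc_runs (σ := σ) r c (Function.update x i (l ++ rest))
    rw [← update_regState_inr] at h1
    have h2 := ih (fun b hb => hl b (List.mem_cons_of_mem _ hb))
      (Function.update c r (c r + 1)) (Function.update x i (l ++ rest)) (by simp) (by
        rw [Function.update_self, Function.update_idem, Function.update_idem, Nat.add_assoc,
          Nat.add_comm 1]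
        exact hend)
    have hx' : regState c x (.inr i) = a :: (l ++ rest) := hx
    refine (Frag.loopWhile_cons (Γ := RegAlphabet R A) hx' (hl a List.mem_cons_self) h1 h2).mono ?_
    rw [List.length_cons]
    omega

theorem drain_runs (i : X) (r : R) (c : R → ℕ) (x : ∀ i, List (A i)) :
    (drain i (fun _ => true) r : RegFrag R A σ).Runs (regState c x)
      (regState (Function.update c r (c r + (x i).length)) (Function.update x i []))
      ((x i).length * 2 + 1) := by
  refine drain_round (rest := []) i _ r (fun _ _ => rfl) c x (by simp) ?_
  have h : regState (Function.update c r (c r + (x i).length)) (Function.update x i [])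
      (.inr i) = [] := by simp [regState]
  exact Frag.loopWhile_nil (Γ := RegAlphabet R A) _ _ h

theorem drain_runs_stop (i : X) (p : A i → Bool) (r : R) {l rest : List (A i)} {a : A i}
    (hl : ∀ a ∈ l, p a = true) (ha : p a = false) (c : R → ℕ) (x : ∀ i, List (A i))
    (hx : x i = l ++ a :: rest) :
    (drain i p r : RegFrag R A σ).Runs (regState c x)
      (regState (Function.update c r (c r + l.length)) (Function.update x i rest))
      (l.length * 2 + 1) := by
  refine drain_round i p r hl c x hx ?_
  have h : regState (Function.update c r (c r + l.length)) (Function.update x i (a :: rest))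
      (.inr i) = a :: rest := by simp [regState]
  have := Frag.loopWhile_stop (Γ := RegAlphabet R A) (inc r : RegFrag R A σ) h ha
  rwa [update_regState_inr, Function.update_idem] at this

theorem loop_emit_runs (i : X) (a : A i) (r : R) (c : R → ℕ) (x : ∀ i, List (A i)) :
    (loop r (emit i a) : RegFrag R A σ).Runs (regState c x)
      (regState (Function.update c r 0) (Function.update x i (List.replicate (c r) a ++ x i)))
      (c r * 2 + 1) := by
  have := loop_runs (σ := σ) (r := r) (F := emit i a) (t := 1) (N := c r)
    (c := fun j => Function.update c r (c r - j))
    (x := fun j => Function.update x i (List.replicate j a ++ x i))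
    (fun j _ => by simp) (fun j hj => by
      have := emit_runs (σ := σ) i a (Function.update (Function.update c r (c r - j)) r
        (c r - (j + 1))) (Function.update x i (List.replicate j a ++ x i))
      rw [Function.update_self, Function.update_idem, ← List.cons_append,
        ← List.replicate_succ] at this
      rwa [Function.update_idem] at this ⊢)
  simpa using this

end RegFrag

namespace CounterPoly

open Polynomial RegFrag

variable {k : ℕ}

/-- A computable bit, pushed on the stack `i` in the form of one of two symbols. -/
theorem exists_emit {f : (Fin k → ℕ) → ℕ} (hf : CounterPoly f) (hf1 : ∀ v, f v ≤ 1) :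
    ∃ (s : ℕ) (p : ℕ[X]), ∀ (R X : Type) [DecidableEq R] [DecidableEq X] (A : X → Type) (σ : Type)
      (args : Fin k → R) (scr : ℕ → R) (i : X) (sym : ℕ → A i),
      (∀ i, ∀ j < s, args i ≠ scr j) → (∀ i < s, ∀ j < s, scr i = scr j → i = j) →
      ∃ F : RegFrag R A σ, ∀ (c : R → ℕ) (x : ∀ i, List (A i)), (∀ j < s, c (scr j) = 0) →
        F.Runs (regState c x)
          (regState c (Function.update x i (sym (f fun i => c (args i)) :: x i)))
          (p.eval (∑ i, c (args i))) := by
  obtain ⟨-, s', p', hG⟩ := one.sub hf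
  obtain ⟨-, s, p, hF⟩ := hf
  refine ⟨max s s' + 2, p + p' + 6, fun R X _ _ A σ args scr i sym h2 h4 => ?_⟩
  have inj : ∀ i < max s s' + 2, ∀ j < max s s' + 2, i ≠ j → scr i ≠ scr j :=
    fun i hi j hj hij h => hij (h4 i hi j hj h)
  obtain ⟨F, hF⟩ := hF R X A σ args (scr 0) (fun j => scr (j + 2)) (fun i => h2 i _ (by omega))
    (fun i j hj => h2 i _ (by omega)) (fun j hj => inj _ (by omega) _ (by omega) (by omega))
    (fun i hi j hj h => by have := h4 _ (by omega) _ (by omega) h; omega)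
  obtain ⟨G, hG⟩ := hG R X A σ args (scr 1) (fun j => scr (j + 2)) (fun i => h2 i _ (by omega))
    (fun i j hj => h2 i _ (by omega)) (fun j hj => inj _ (by omega) _ (by omega) (by omega))
    (fun i hi j hj h => by have := h4 _ (by omega) _ (by omega) h; omega)
  refine ⟨((F.seq G).seq (loop (scr 0) (emit i (sym 1)))).seq (loop (scr 1) (emit i (sym 0))),
    fun c x h0 => ?_⟩
  have n01 := inj 0 (by omega) 1 (by omega) (by omega)
  have z0 := h0 0 (by omega)
  have z1 := h0 1 (by omega)
  have hb := hf1 fun i => c (args i)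
  have r1 := hF c x (fun j hj => h0 _ (by omega))
  have r2 := hG (Function.update c (scr 0) (c (scr 0) + f fun i => c (args i))) x (fun j hj => by
    rw [Function.update_of_ne (inj _ (by omega) _ (by omega) (by omega))]; exact h0 _ (by omega))
  have e2 : (fun i => Function.update c (scr 0) (c (scr 0) + f fun i => c (args i)) (args i)) =
      fun i => c (args i) := funext fun i => Function.update_of_ne (h2 i 0 (by omega)) _ _
  rw [e2, Function.update_of_ne n01.symm, z0, z1, zero_add, zero_add] at r2
  rw [z0, zero_add] at r1
  beta_reduce at r2
  generalize f (fun i => c (args i)) = b at *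
  have r3 := loop_emit_runs (σ := σ) i (sym 1) (scr 0)
    (Function.update (Function.update c (scr 0) b) (scr 1) (1 - b)) x
  have r4 := loop_emit_runs (σ := σ) i (sym 0) (scr 1) (Function.update (Function.update
    (Function.update c (scr 0) b) (scr 1) (1 - b)) (scr 0) 0) (Function.update x i
      (List.replicate (Function.update (Function.update c (scr 0) b) (scr 1) (1 - b) (scr 0))
        (sym 1) ++ x i))
  have v0 : Function.update (Function.update c (scr 0) b) (scr 1) (1 - b) (scr 0) = b := by
    simp [n01]
  have v1 : Function.update (Function.update (Function.update c (scr 0) b) (scr 1) (1 - b))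
      (scr 0) 0 (scr 1) = 1 - b := by simp [n01.symm]
  rw [v0] at r3 r4
  rw [v1] at r4
  have h := (((r1.seq r2).seq r3).seq r4).mono (t' := (p + p' + 6).eval (∑ i, c (args i))) (by
    simp only [eval_add, eval_ofNat]
    change eval (∑ i, c (args i)) p + eval (∑ i, c (args i)) p' + (b * 2 + 1) +
      ((1 - b) * 2 + 1) ≤ eval (∑ i, c (args i)) p + eval (∑ i, c (args i)) p' + 6
    omega)
  convert h using 2
  · funext r
    by_cases hr0 : r = scr 0
    · subst hr0; simp [n01, z0]
    · by_cases hr1 : r = scr 1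
      · subst hr1; simp [z1]
      · simp [hr0, hr1]
  · rw [Function.update_self, Function.update_idem]
    interval_cases b <;> simp

/-- The list of all entries of a matrix, row after row, with a symbol at the end of each row. -/
def matrixWord {S : Type} (sym : ℕ → S) (sep : S) (n m : ℕ) (f : ℕ → ℕ → ℕ) : List S :=
  (List.range n).flatMap fun i => (List.range m).map (fun j => sym (f i j)) ++ [sep]

/-- The output phase: from the weight bound `w` and the number `n` of rows, in the counters `rw`
and `rn`, a matrix with computable entries is written. -/
theorem exists_output {cols : (Fin 2 → ℕ) → ℕ} {entry : (Fin 4 → ℕ) → ℕ} (hc : CounterPoly cols)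
    (he : CounterPoly entry) (he1 : ∀ v, entry v ≤ 1) :
    ∃ (s : ℕ) (p : ℕ[X]), ∀ (R X : Type) [DecidableEq R] [DecidableEq X] (A : X → Type) (σ : Type)
      (rw rn : R) (scr : ℕ → R) (o : X) (sym : ℕ → A o) (sep : A o), rw ≠ rn →
      (∀ j < s, rw ≠ scr j) → (∀ j < s, rn ≠ scr j) → (∀ i < s, ∀ j < s, scr i = scr j → i = j) →
      ∃ F : RegFrag R A σ, ∀ (w n : ℕ) (x : ∀ i, List (A i)),
        F.Runs (regState (Function.update (Function.update 0 rw w) rn n) x)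
          (regState 0 (Function.update x o (matrixWord sym sep n (cols ![w, n])
            (fun i j => entry ![w, n, i, j]) ++ x o)))
          (p.eval (w + n)) := by
  obtain ⟨s', pe, hE⟩ := he.exists_emit he1
  obtain ⟨⟨qc, bc⟩, s'', pc, hC⟩ := hc
  refine ⟨max s' s'' + 2, (X * 5 + 2) + (X * ((1 + pc + (qc * (pe.comp (X + X + qc) + 1) + 1)) + 1)
    + 1) + (X * 2 + 1) + (X * 2 + 1), fun R X _ _ A σ rw rn scr o sym sep hwn hw hn h4 => ?_⟩
  set s := max s' s'' with hs
  have inj : ∀ i < s + 2, ∀ j < s + 2, i ≠ j → scr i ≠ scr j :=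
    fun i hi j hj hij h => hij (h4 i hi j hj h)
  obtain ⟨C, hC⟩ := hC R X A σ ![rw, rn] (scr 1) (fun j => scr (j + 2))
    (fun i => by fin_cases i; exacts [hw _ (by omega), hn _ (by omega)])
    (fun i j hj => by fin_cases i; exacts [hw _ (by omega), hn _ (by omega)])
    (fun j hj => inj _ (by omega) _ (by omega) (by omega))
    (fun i hi j hj h => by have := h4 _ (by omega) _ (by omega) h; omega)
  obtain ⟨E, hE⟩ := hE R X A σ ![rw, rn, scr 0, scr 1] (fun j => scr (j + 2)) o sym
    (fun i j hj => by
      fin_cases i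
      exacts [hw _ (by omega), hn _ (by omega), inj _ (by omega) _ (by omega) (by omega),
        inj _ (by omega) _ (by omega) (by omega)])
    (fun i hi j hj h => by have := h4 _ (by omega) _ (by omega) h; omega)
  refine ⟨(((copy rn (scr 0) (scr 1)).seq (loop (scr 0) (((emit o sep).seq C).seq
    (loop (scr 1) E)))).seq (clear rw)).seq (clear rn), fun w n x => ?_⟩
  have n01 := inj 0 (by omega) 1 (by omega) (by omega)
  have w0 := hw 0 (by omega)
  have w1 := hw 1 (by omega)
  have m0 := hn 0 (by omega)
  have m1 := hn 1 (by omega)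
  set m := cols ![w, n] with hm
  set f : ℕ → ℕ → ℕ := fun i j => entry ![w, n, i, j] with hf
  -- the counters, with row counter `i` and column counter `j`
  let st : ℕ → ℕ → R → ℕ := fun i j => Function.update (Function.update (Function.update
    (Function.update 0 rw w) rn n) (scr 0) i) (scr 1) j
  have stz : ∀ i j, ∀ l < s, st i j (scr (l + 2)) = 0 := by
    intro i j l hl
    simp only [st]
    rw [Function.update_of_ne (inj _ (by omega) _ (by omega) (by omega)),
      Function.update_of_ne (inj _ (by omega) _ (by omega) (by omega)),
      Function.update_of_ne (hn _ (by omega)).symm, Function.update_of_ne (hw _ (by omega)).symm]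
    rfl
  have stw : ∀ i j, st i j rw = w := fun i j => by simp [st, w0, w1, hwn]
  have stn : ∀ i j, st i j rn = n := fun i j => by simp [st, m0, m1]
  have st0 : ∀ i j, st i j (scr 0) = i := fun i j => by simp [st, n01]
  have st1 : ∀ i j, st i j (scr 1) = j := fun i j => by simp [st]
  have up1 : ∀ i j j', Function.update (st i j) (scr 1) j' = st i j' := fun i j j' => by
    simp [st]
  have up0 : ∀ i j i', Function.update (st i j) (scr 0) i' = st i' j := fun i j i' => by
    simp only [st]
    rw [Function.update_comm n01.symm, Function.update_idem]
  have bm : m ≤ qc.eval (w + n) := by simpa using bc ![w, n]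
  have arg2 : ∀ i j, (fun l => st i j ((![rw, rn] : Fin 2 → R) l)) = ![w, n] := fun i j => by
    funext l; fin_cases l; exacts [stw i j, stn i j]
  have arg4 : ∀ i j, (fun l => st i j ((![rw, rn, scr 0, scr 1] : Fin 4 → R) l)) =
      ![w, n, i, j] := fun i j => by
    funext l; fin_cases l; exacts [stw i j, stn i j, st0 i j, st1 i j]
  -- writing one row
  have row : ∀ i < n, ∀ y : ∀ i, List (A i),
      (((emit o sep).seq C).seq (loop (scr 1) E)).Runs (regState (st i 0) y)
        (regState (st i 0) (Function.update y o
          ((List.range m).map (fun j => sym (f i j)) ++ sep :: y o)))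
        (1 + pc.eval (w + n) + (qc.eval (w + n) *
          (pe.eval (w + n + (w + n) + qc.eval (w + n)) + 1) + 1)) := by
    intro i hi y
    have r1 := emit_runs (σ := σ) o sep (st i 0) y
    have r2 := hC (st i 0) (Function.update y o (sep :: y o)) (fun j hj => stz _ _ _ (by omega))
    have e2 : Finset.univ.sum (![w, n] : Fin 2 → ℕ) = w + n := Fin.sum_univ_two _
    rw [arg2, e2, st1, zero_add, up1] at r2
    have r3 := loop_runs (σ := σ) (r := scr 1) (F := E) (N := m)
      (t := pe.eval (w + n + (w + n) + qc.eval (w + n))) (c := fun j => st i (m - j))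
      (x := fun j => Function.update y o
        (((List.range m).drop (m - j)).map (fun j => sym (f i j)) ++ sep :: y o))
      (fun j _ => st1 _ _) (fun j hj => by
        have q := hE (st i (m - (j + 1))) (Function.update y o
          (((List.range m).drop (m - j)).map (fun j => sym (f i j)) ++ sep :: y o))
          (fun j hj => stz _ _ _ (by omega))
        have e4 : Finset.univ.sum (![w, n, i, m - (j + 1)] : Fin 4 → ℕ) =
            w + n + i + (m - (j + 1)) := Fin.sum_univ_four _
        rw [arg4, e4, Function.update_idem, Function.update_self] at q
        rw [up1]
        have hd : (List.range m).drop (m - (j + 1)) =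
            (m - (j + 1)) :: (List.range m).drop (m - j) := by
          rw [List.drop_eq_getElem_cons (by simp; omega), List.getElem_range]
          congr 2
          omega
        rw [hd, List.map_cons, List.cons_append]
        exact q.mono (pe.eval_mono_nat (by omega)))
    rw [Nat.sub_self, Nat.sub_zero, List.drop_zero, List.drop_eq_nil_of_le (by simp)] at r3
    refine ((r1.seq r2).seq r3).mono ?_
    have := Nat.mul_le_mul_right (pe.eval (w + n + (w + n) + qc.eval (w + n)) + 1) bm
    omega
  have r1 := copy_runs (σ := σ) m0 m1 n01 (Function.update (Function.update (0 : R → ℕ) rw w) rn n)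
    (by rw [Function.update_of_ne m1.symm, Function.update_of_ne w1.symm]; rfl) x
  have c0 : Function.update (Function.update (0 : R → ℕ) rw w) rn n (scr 0) = 0 := by
    rw [Function.update_of_ne m0.symm, Function.update_of_ne w0.symm]; rfl
  have c1 : Function.update (Function.update (0 : R → ℕ) rw w) rn n (scr 1) = 0 := by
    rw [Function.update_of_ne m1.symm, Function.update_of_ne w1.symm]; rfl
  have s0 : Function.update (Function.update (Function.update (0 : R → ℕ) rw w) rn n) (scr 0) n = st n 0 := by
    simp only [st]
    rw [eq_comm]
    refine Function.update_eq_iff.2 ⟨?_, fun _ _ => rfl⟩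
    rw [Function.update_of_ne n01.symm, c1]
  rw [c0, Function.update_self, zero_add, s0] at r1
  have r2 := loop_runs (σ := σ) (r := scr 0) (F := ((emit o sep).seq C).seq (loop (scr 1) E))
    (N := n) (t := 1 + pc.eval (w + n) + (qc.eval (w + n) *
      (pe.eval (w + n + (w + n) + qc.eval (w + n)) + 1) + 1)) (c := fun i => st (n - i) 0)
    (x := fun i => Function.update x o (((List.range n).drop (n - i)).flatMap
      (fun i => (List.range m).map (fun j => sym (f i j)) ++ [sep]) ++ x o))
    (fun i _ => st0 _ _) (fun i hi => by
      have q := row (n - (i + 1)) (by omega) (Function.update x o (((List.range n).drop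
        (n - i)).flatMap (fun i => (List.range m).map (fun j => sym (f i j)) ++ [sep]) ++ x o))
      rw [Function.update_idem, Function.update_self] at q
      have hd : (List.range n).drop (n - (i + 1)) =
          (n - (i + 1)) :: (List.range n).drop (n - i) := by
        rw [List.drop_eq_getElem_cons (by simp; omega), List.getElem_range]
        congr 2
        omega
      rw [up0, hd, List.flatMap_cons]
      simpa using q)
  rw [Nat.sub_self, Nat.sub_zero, List.drop_zero, List.drop_eq_nil_of_le (by simp)] at r2
  have hx : Function.update x o (List.flatMap (fun i => (List.range m).map
      (fun j => sym (f i j)) ++ [sep]) [] ++ x o) = x := by simp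
  rw [hx] at r2
  have r3 := clear_runs (σ := σ) rw (st 0 0) (Function.update x o (matrixWord sym sep n m f ++ x o))
  have r4 := clear_runs (σ := σ) rn (Function.update (st 0 0) rw 0)
    (Function.update x o (matrixWord sym sep n m f ++ x o))
  have v1 : Function.update (st 0 0) rw 0 rn = n := by
    rw [Function.update_of_ne hwn.symm, stn]
  have v2 : Function.update (Function.update (st 0 0) rw 0) rn 0 = 0 := by
    funext r
    by_cases h1 : r = rn
    · subst h1; simp
    · by_cases h2 : r = rw
      · subst h2; simp [h1]
      · by_cases h3 : r = scr 0
        · subst h3; simp [h1, h2, st0]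
        · by_cases h5 : r = scr 1
          · subst h5; simp [h1, h2, st1]
          · simp [st, h1, h2, h3, h5]
  rw [stw] at r3
  rw [v1, v2] at r4
  refine (((r1.seq r2).seq r3).seq r4).mono ?_
  simp only [eval_add, eval_mul, eval_X, eval_ofNat, eval_one, eval_comp]
  have := Nat.mul_le_mul_right ((1 + pc.eval (w + n) + (qc.eval (w + n) *
      (pe.eval (w + n + (w + n) + qc.eval (w + n)) + 1) + 1)) + 1) (Nat.le_add_left n w)
  omega

end CounterPoly

/-! ### Machines with an input and an output stack -/

/-- The alphabets of the further stacks: the alphabets `B` of a subroutine, bits for the input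
stack, and matrix symbols for the output stack. -/
abbrev IOAlphabet {Y : Type} (B : Y → Type) : Y ⊕ Bool → Type
  | .inl y => B y
  | .inr false => Bool
  | .inr true => Option (ZMod 2)

section IOState

variable {Y : Type} [DecidableEq Y] {B : Y → Type}

/-- The further stacks, with contents `S` of the stacks of the subroutine, `a` of the input stack
and `b` of the output stack. -/
def ioState (S : ∀ y, List (B y)) (a : List Bool) (b : List (Option (ZMod 2))) :
    ∀ i, List (IOAlphabet B i)
  | .inl y => S y
  | .inr false => a
  | .inr true => b

theorem update_ioState_inl (S : ∀ y, List (B y)) (a : List Bool) (b : List (Option (ZMod 2)))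
    (y : Y) (l : List (B y)) :
    Function.update (ioState S a b) (.inl y) l = ioState (Function.update S y l) a b := by
  funext i
  rcases i with z | (_ | _)
  · by_cases h : z = y
    · subst h
      rw [Function.update_self, ioState, Function.update_self]
    · rw [Function.update_of_ne (by simpa using h)]
      simp [ioState, Function.update_of_ne h]
  all_goals
    rw [Function.update_of_ne (by simp)]
    rfl

theorem update_ioState_input (S : ∀ y, List (B y)) (a a' : List Bool)
    (b : List (Option (ZMod 2))) :
    Function.update (ioState S a b) (.inr false) a' = ioState S a' b := by
  funext i
  rcases i with z | (_ | _)
  · rw [Function.update_of_ne (by simp)]; rfl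
  · rw [Function.update_self]; rfl
  · rw [Function.update_of_ne (by simp)]; rfl

theorem update_ioState_output (S : ∀ y, List (B y)) (a : List Bool)
    (b b' : List (Option (ZMod 2))) :
    Function.update (ioState S a b) (.inr true) b' = ioState S a b' := by
  funext i
  rcases i with z | (_ | _)
  · rw [Function.update_of_ne (by simp)]; rfl
  · rw [Function.update_of_ne (by simp)]; rfl
  · rw [Function.update_self]; rfl

end IOState

open Turing in
/-- A final statement brings the internal state to `v₀`, as is required of a machine at the end. -/
theorem Frag.Runs.reset {K : Type} [DecidableEq K] {Γ : K → Type} {σ : Type} {F : Frag K Γ σ}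
    {S S' : ∀ k, List (Γ k)} {t : ℕ} (h : F.Runs S S' t) (v₀ v : σ) :
    ∃ s ≤ t + 1, StepsIn (F.seq (Frag.single (.load (fun _ => v₀) .halt))).code s
      ⟨some (F.seq (Frag.single (.load (fun _ => v₀) .halt))).entry, v, S⟩ ⟨none, v₀, S'⟩ := by
  obtain ⟨v', s, hs, h⟩ := h v
  refine ⟨s + 1, by omega, ?_⟩
  exact (Frag.stepsIn_link
    (m' := (F.seq (Frag.single (.load (fun _ => v₀) .halt))).code) (fun _ => rfl) h rfl rfl).trans
      (.head rfl (.refl _))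

/-- The machine whose program is the code `P`, with numbered counters. -/
def RegFrag.toFinTM2 {N : ℕ} {Y : Type} [DecidableEq Y] [Fintype Y] {B : Y → Type} {σ : Type}
    [Fintype σ] (P : RegFrag (Fin N) (IOAlphabet B) σ) (v₀ : σ) : Turing.FinTM2 :=
  letI := P.fin
  { K := Fin N ⊕ (Y ⊕ Bool)
    k₀ := .inr (.inr false)
    k₁ := .inr (.inr true)
    Γ := RegAlphabet (Fin N) (IOAlphabet B)
    Λ := P.Λ
    main := P.entry
    σ := Bool × σ
    initialState := (false, v₀)
    Γk₀Fin := inferInstanceAs (Fintype Bool)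
    m := P.code }

theorem initList_toFinTM2 {N : ℕ} {Y : Type} [DecidableEq Y] [Fintype Y] {B : Y → Type} {σ : Type}
    [Fintype σ] (P : RegFrag (Fin N) (IOAlphabet B) σ) (v₀ : σ) (a : List Bool) :
    Turing.initList (P.toFinTM2 v₀) a =
      ⟨some P.entry, (false, v₀), regState 0 (ioState (fun _ => []) a [])⟩ := by
  unfold Turing.initList
  congr 1
  funext k
  rcases k with r | (y | (_ | _))
  all_goals first | exact dif_neg (by rintro ⟨⟩) | exact dif_pos rfl

theorem haltList_toFinTM2 {N : ℕ} {Y : Type} [DecidableEq Y] [Fintype Y] {B : Y → Type} {σ : Type}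
    [Fintype σ] (P : RegFrag (Fin N) (IOAlphabet B) σ) (v₀ : σ) (b : List (Option (ZMod 2))) :
    Turing.haltList (P.toFinTM2 v₀) b =
      ⟨none, (false, v₀), regState 0 (ioState (fun _ => []) [] b)⟩ := by
  unfold Turing.haltList
  congr 1
  funext k
  rcases k with r | (y | (_ | _))
  all_goals first | exact dif_neg (by rintro ⟨⟩) | exact dif_pos rfl

/-- There is a piece of code that reads the encoding of `a` from the input stack, puts the numbers
`w a` and `n a` into two counters and leaves all other stacks empty, in polynomial time. -/
def InputPhase {α Y : Type} [DecidableEq Y] (B : Y → Type) (σ : Type) (ea : α → List Bool)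
    (w n : α → ℕ) : Prop :=
  ∃ (s : ℕ) (p : Polynomial ℕ), ∀ (R : Type) [DecidableEq R] (rw rn : R) (scr : ℕ → R), rw ≠ rn →
    (∀ j < s, rw ≠ scr j) → (∀ j < s, rn ≠ scr j) → (∀ i < s, ∀ j < s, scr i = scr j → i = j) →
    ∃ F : RegFrag R (IOAlphabet B) σ, ∀ a,
      F.Runs (regState 0 (ioState (fun _ => []) (ea a) []))
        (regState (Function.update (Function.update 0 rw (w a)) rn (n a))
          (ioState (fun _ => []) [] [])) (p.eval (ea a).length)

theorem encodeBinMatrix_natCast (n m : ℕ) (f : ℕ → ℕ → ℕ) :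
    encodeBinMatrix ⟨n, m, fun i j => (f i j : ZMod 2)⟩ =
      CounterPoly.matrixWord (fun k => some (k : ZMod 2)) none n m f := by
  unfold encodeBinMatrix CounterPoly.matrixWord
  rw [← @List.map_coe_finRange_eq_range n, ← @List.map_coe_finRange_eq_range m, List.flatMap_map]
  congr 1
  funext i
  rw [List.map_map]
  rfl

/-- An input phase followed by the output phase makes up a machine that writes a matrix with
computable entries. -/
theorem InputPhase.nonempty_computableInPolyTime {α Y : Type} [DecidableEq Y] [Fintype Y]
    {B : Y → Type} {σ : Type} [Fintype σ] (v₀ : σ) {ea : α → List Bool} {w n : α → ℕ}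
    (h : InputPhase B σ ea w n) {b : Polynomial ℕ} (hb : ∀ a, w a + n a ≤ b.eval (ea a).length)
    {cols : (Fin 2 → ℕ) → ℕ} {entry : (Fin 4 → ℕ) → ℕ} (hc : CounterPoly cols)
    (he : CounterPoly entry) (he1 : ∀ v, entry v ≤ 1) :
    Nonempty (Turing.TM2ComputableInPolyTime ea encodeBinMatrix fun a =>
      ⟨n a, cols ![w a, n a], fun i j => (entry ![w a, n a, i, j] : ZMod 2)⟩) := by
  obtain ⟨s, p, hI⟩ := h
  obtain ⟨s', p', hO⟩ := CounterPoly.exists_output hc he he1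
  -- the counters `0` and `1` hold the numbers `w a` and `n a`, the others are scratch
  let scr : ℕ → Fin (max s s' + 2) := fun j => Fin.ofNat _ (j + 2)
  have hscr : ∀ j < max s s', (scr j).val = j + 2 := fun j hj =>
    Nat.mod_eq_of_lt (by omega)
  have h0 : ∀ j < max s s', (0 : Fin (max s s' + 2)) ≠ scr j := fun j hj h => by
    have := congrArg Fin.val h
    rw [hscr j hj] at this
    simp at this
  have h1 : ∀ j < max s s', (1 : Fin (max s s' + 2)) ≠ scr j := fun j hj h => by
    have := congrArg Fin.val h
    rw [hscr j hj] at this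
    simp at this
  have h2 : ∀ i < max s s', ∀ j < max s s', scr i = scr j → i = j := fun i hi j hj h => by
    have := congrArg Fin.val h
    rw [hscr i hi, hscr j hj] at this
    omega
  obtain ⟨I, hI⟩ := hI (Fin (max s s' + 2)) 0 1 scr (by simp) (fun j hj => h0 j (by omega))
    (fun j hj => h1 j (by omega)) (fun i hi j hj => h2 i (by omega) j (by omega))
  obtain ⟨O, hO⟩ := hO (Fin (max s s' + 2)) (Y ⊕ Bool) (IOAlphabet B) σ 0 1 scr (.inr true)
    (fun k => some (k : ZMod 2)) none (by simp) (fun j hj => h0 j (by omega))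
    (fun j hj => h1 j (by omega)) (fun i hi j hj => h2 i (by omega) j (by omega))
  let P : RegFrag (Fin (max s s' + 2)) (IOAlphabet B) σ :=
    (I.seq O).seq (Frag.single (.load (fun _ => (false, v₀)) .halt))
  have hP : ∀ a, ∃ t ≤ (p + p'.comp b + 1).eval (ea a).length, StepsIn P.code t
      (Turing.initList (P.toFinTM2 v₀) (ea a)) (Turing.haltList (P.toFinTM2 v₀)
        (encodeBinMatrix ⟨n a, cols ![w a, n a],
          fun i j => (entry ![w a, n a, i, j] : ZMod 2)⟩)) := by
    intro a
    rw [initList_toFinTM2, haltList_toFinTM2, encodeBinMatrix_natCast _ _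
      (fun i j => entry ![w a, n a, i, j])]
    have r := hO (w a) (n a) (ioState (fun _ => []) [] [])
    rw [update_ioState_output, show ioState (fun _ => []) [] [] (.inr true) = [] from rfl,
      List.append_nil] at r
    obtain ⟨t, ht, h⟩ := ((hI a).seq r).reset (false, v₀) (false, v₀)
    refine ⟨t, ht.trans ?_, ?_⟩
    · have := p'.eval_mono_nat (hb a)
      simp only [Polynomial.eval_add, Polynomial.eval_comp, Polynomial.eval_one]
      omega
    · exact h
  choose t ht hP using hP
  have hrun : ∀ a l₀ l₁, l₀ = ea a → l₁ = encodeBinMatrix ⟨n a, cols ![w a, n a],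
      fun i j => (entry ![w a, n a, i, j] : ZMod 2)⟩ →
      (flip bind (P.toFinTM2 v₀).step)^[t a] (some (Turing.initList (P.toFinTM2 v₀) l₀)) =
        some (Turing.haltList (P.toFinTM2 v₀) l₁) := by
    rintro a _ _ rfl rfl
    exact StepsIn.iff_iterate.1 (hP a)
  exact ⟨⟨⟨P.toFinTM2 v₀, Equiv.refl _, Equiv.refl _⟩, p + p'.comp b + 1, fun a =>
    ⟨⟨t a, hrun a _ _ (List.map_id _) (List.map_id _)⟩, ht a⟩⟩⟩

/-! ### Reading the input -/

theorem unaryEncodeNat_eq_replicate (n : ℕ) :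
    Computability.unaryEncodeNat n = List.replicate n true := by
  induction n with
  | zero => rfl
  | succ n ih => rw [Computability.unaryEncodeNat, ih, List.replicate_succ]

section InputPhase

open RegFrag Polynomial

theorem inputPhase_encodeUnaryPair :
    InputPhase (fun _ : Empty => Empty) Unit encodeUnaryPair Prod.fst Prod.snd := by
  refine ⟨0, X * 4 + 2, fun R _ rw rn scr hwn _ _ _ =>
    ⟨(drain (.inr false) id rw).seq (drain (.inr false) (fun _ => true) rn), fun a => ?_⟩⟩
  have r1 := drain_runs_stop (σ := Unit) (A := IOAlphabet fun _ : Empty => Empty) (.inr false) id rw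
    (l := List.replicate a.1 true) (rest := List.replicate a.2 true) (a := false)
    (fun b hb => List.eq_of_mem_replicate hb) rfl 0
    (ioState (fun _ => []) (encodeUnaryPair a) []) (by
      rw [← unaryEncodeNat_eq_replicate, ← unaryEncodeNat_eq_replicate]; rfl)
  rw [update_ioState_input, List.length_replicate] at r1
  have r2 := drain_runs (σ := Unit) (A := IOAlphabet fun _ : Empty => Empty) (.inr false) rn
    (Function.update 0 rw a.1) (ioState (fun _ => []) (List.replicate a.2 true) [])
  rw [update_ioState_input, Function.update_of_ne hwn.symm,
    show (ioState (fun _ => []) (List.replicate a.2 true) [] (.inr false) :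
      List (IOAlphabet (fun _ : Empty => Empty) (.inr false))).length = a.2 from
      List.length_replicate] at r2
  have hl : (encodeUnaryPair a).length = a.1 + a.2 + 1 := by
    simp [encodeUnaryPair, unaryEncodeNat_eq_replicate, add_assoc]
  have e1 : (0 : R → ℕ) rw + a.1 = a.1 := zero_add _
  have e2 : (0 : R → ℕ) rn + a.2 = a.2 := zero_add _
  rw [e1] at r1
  rw [e2] at r2
  refine (r1.seq r2).mono ?_
  simp only [hl, eval_add, eval_mul, eval_X, eval_ofNat]
  omega

theorem inputPhase_of_counterPoly {f : ℕ → ℕ} (hf : CounterPoly fun v : Fin 1 → ℕ => f (v 0)) :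
    InputPhase (fun _ : Empty => Empty) Unit Computability.unaryEncodeNat f (fun n => n) := by
  obtain ⟨-, s, p, hF⟩ := hf
  refine ⟨s, X * 2 + 1 + p, fun R _ rw rn scr hwn hw hn hs => ?_⟩
  obtain ⟨F, hF⟩ := hF R (Empty ⊕ Bool) (IOAlphabet fun _ : Empty => Empty) Unit (fun _ => rn) rw
    scr (fun _ => hwn.symm) (fun _ => hn) hw hs
  refine ⟨(drain (.inr false) (fun _ => true) rn).seq F, fun n => ?_⟩
  have r1 := drain_runs (σ := Unit) (A := IOAlphabet fun _ : Empty => Empty) (.inr false) rn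
    0 (ioState (fun _ => []) (Computability.unaryEncodeNat n) [])
  rw [update_ioState_input,
    show (ioState (fun _ => []) (Computability.unaryEncodeNat n) [] (.inr false) :
      List (IOAlphabet (fun _ : Empty => Empty) (.inr false))).length = n by
      rw [unaryEncodeNat_eq_replicate]; exact List.length_replicate,
    show (0 : R → ℕ) rn + n = n from zero_add _] at r1
  have r2 := hF (Function.update 0 rn n) (ioState (fun _ => []) [] []) (fun j hj =>
    Function.update_of_ne (hn j hj).symm _ _)
  rw [Function.update_self, Function.update_of_ne hwn,
    show (0 : R → ℕ) rw + f n = f n from zero_add _, Function.update_comm hwn.symm] at r2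
  refine (r1.seq r2).mono ?_
  simp [unaryEncodeNat_eq_replicate]

end InputPhase

/-! ### Subroutines given by machines -/

namespace Turing.TM2

variable {R Y : Type} {B : Y → Type} {Λ σ : Type}

/-- The statement `q` as a statement of a larger machine, whose labels are those of the original
machine and an initial one. -/
def Stmt.lift : Stmt B Λ σ → Stmt (RegAlphabet R (IOAlphabet B)) (Option Λ) (Bool × σ)
  | .push k f q => .push (.inr (.inl k)) (fun v => f v.2) q.lift
  | .peek k f q => .peek (.inr (.inl k)) (fun v o => (v.1, f v.2 o)) q.lift
  | .pop k f q => .pop (.inr (.inl k)) (fun v o => (v.1, f v.2 o)) q.lift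
  | .load f q => .load (fun v => (v.1, f v.2)) q.lift
  | .branch f q₁ q₂ => .branch (fun v => f v.2) q₁.lift q₂.lift
  | .goto f => .goto fun v => some (f v.2)
  | .halt => .halt

variable [DecidableEq R] [DecidableEq Y]

theorem stepAux_lift (q : Stmt B Λ σ) (v : Bool × σ) (c : R → ℕ) (S : ∀ y, List (B y))
    (a : List Bool) (b : List (Option (ZMod 2))) :
    stepAux q.lift v (regState c (ioState S a b)) =
      ⟨(stepAux q v.2 S).l.map some, (v.1, (stepAux q v.2 S).var),
        regState c (ioState (stepAux q v.2 S).stk a b)⟩ := by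
  induction q generalizing v S with
  | push k f q ih =>
    simp only [Stmt.lift, stepAux]
    rw [RegFrag.update_regState_inr, update_ioState_inl]
    exact ih _ _
  | peek k f q ih => exact ih _ _
  | pop k f q ih =>
    simp only [Stmt.lift, stepAux]
    rw [RegFrag.update_regState_inr, update_ioState_inl]
    exact ih _ _
  | load f q ih => exact ih _ _
  | branch f q₁ q₂ ih₁ ih₂ =>
    simp only [Stmt.lift, stepAux]
    cases f v.2
    · exact ih₂ _ _
    · exact ih₁ _ _
  | goto f => rfl
  | halt => rfl

end Turing.TM2

namespace RegFrag

variable {R Y : Type} [DecidableEq R] [DecidableEq Y] {B : Y → Type} {Λ σ : Type} [Fintype Λ]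

/-- The code `m`, started at `main` with the internal state `v₀`, as a piece of code. -/
def call (m : Λ → Turing.TM2.Stmt B Λ σ) (main : Λ) (v₀ : σ) : RegFrag R (IOAlphabet B) σ where
  Λ := Option Λ
  fin := inferInstance
  entry := none
  code l := l.elim (.load (fun v => (v.1, v₀)) (.goto fun _ => some main)) fun l => (m l).lift

theorem call_runs {m : Λ → Turing.TM2.Stmt B Λ σ} {main : Λ} {v₀ v₁ : σ} {t : ℕ}
    {S S' : ∀ y, List (B y)} (h : StepsIn m t ⟨some main, v₀, S⟩ ⟨none, v₁, S'⟩) (c : R → ℕ)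
    (a : List Bool) (b : List (Option (ZMod 2))) :
    (call m main v₀ : RegFrag R (IOAlphabet B) σ).Runs (regState c (ioState S a b))
      (regState c (ioState S' a b)) (t + 1) := by
  intro v
  have key : ∀ {t x y}, StepsIn m t x y → StepsIn (call m main v₀ : RegFrag R (IOAlphabet B) σ).code
      t ⟨x.l.map some, (v.1, x.var), regState c (ioState x.stk a b)⟩
      ⟨y.l.map some, (v.1, y.var), regState c (ioState y.stk a b)⟩ := by
    intro t x y h
    induction h with
    | refl => exact .refl _
    | @head t x y z hs _ ih =>
      obtain ⟨_ | l, xv, xS⟩ := x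
      · cases hs
      · refine .head ?_ ih
        cases hs
        exact congrArg some (Turing.TM2.stepAux_lift (m l) (v.1, xv) c xS a b)
  exact ⟨(v.1, v₁), t + 1, le_rfl, .head rfl (key h)⟩

end RegFrag

open RegFrag Polynomial in
/-- If `f` is computed by a machine, then `f n` is obtained from `n` by calling that machine: its
stacks are among those of the larger machine, its input is written from a copy of `n`, and its
output is counted. The bound `b` on the values limits the time for counting. -/
theorem inputPhase_of_computableInPolyTime {f : ℕ → ℕ} (M : Turing.TM2ComputableInPolyTime
      Computability.unaryEncodeNat Computability.unaryEncodeNat f) (b : ℕ[X])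
    (hb : ∀ n, f n ≤ b.eval n) :
    InputPhase M.tm.Γ M.tm.σ Computability.unaryEncodeNat f (fun n => n) := by
  let := M.tm.ΛFin
  refine ⟨2, (X * 2 + 1) + (X * 5 + 2) + (X * 2 + 1) + (M.time + 1) + (b * 2 + 1),
    fun R _ rw rn scr hwn hw hn hs => ⟨((((drain (.inr false) (fun _ => true) rn).seq
      (copy rn (scr 0) (scr 1))).seq (loop (scr 0) (emit (.inl M.tm.k₀)
        (M.inputAlphabet.symm true)))).seq (call M.tm.m M.tm.main M.tm.initialState)).seq
          (drain (.inl M.tm.k₁) (fun _ => true) rw), fun n => ?_⟩⟩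
  have n01 : scr 0 ≠ scr 1 := fun h => by have := hs 0 two_pos 1 one_lt_two h; omega
  have m0 := hn 0 two_pos
  have m1 := hn 1 one_lt_two
  have w0 := hw 0 two_pos
  have r1 := drain_runs (σ := M.tm.σ) (A := IOAlphabet M.tm.Γ) (.inr false) rn
    0 (ioState (fun _ => []) (Computability.unaryEncodeNat n) [])
  rw [update_ioState_input,
    show (ioState (fun _ => []) (Computability.unaryEncodeNat n) [] (.inr false) :
      List (IOAlphabet M.tm.Γ (.inr false))).length = n by
      rw [unaryEncodeNat_eq_replicate]; exact List.length_replicate,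
    show (0 : R → ℕ) rn + n = n from zero_add _] at r1
  have r2 := copy_runs (σ := M.tm.σ) m0 m1 n01 (Function.update (0 : R → ℕ) rn n)
    (Function.update_of_ne m1.symm _ _) (A := IOAlphabet M.tm.Γ) (ioState (fun _ => []) [] [])
  rw [Function.update_self, Function.update_of_ne m0.symm,
    show (0 : R → ℕ) (scr 0) + n = n from zero_add _] at r2
  have r3 := loop_emit_runs (σ := M.tm.σ) (A := IOAlphabet M.tm.Γ) (.inl M.tm.k₀)
    (M.inputAlphabet.symm true) (scr 0) (Function.update (Function.update (0 : R → ℕ) rn n)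
      (scr 0) n) (ioState (fun _ => []) [] [])
  have e3 : Function.update (Function.update (0 : R → ℕ) rn n) (scr 0) 0 =
      Function.update (0 : R → ℕ) rn n := by
    rw [Function.update_eq_self_iff, Function.update_of_ne m0.symm]; rfl
  rw [Function.update_self, Function.update_idem, e3, update_ioState_inl] at r3
  -- the stacks before and after the call
  obtain ⟨⟨t, ht⟩, ht'⟩ := M.outputsFun n
  have h4 := StepsIn.iff_iterate.2 ht
  have i4 : Turing.initList M.tm (List.map M.inputAlphabet.invFun (Computability.unaryEncodeNat n))
      = ⟨some M.tm.main, M.tm.initialState, Function.update (fun _ => []) M.tm.k₀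
        (List.replicate n (M.inputAlphabet.symm true) ++ [])⟩ := by
    unfold Turing.initList
    congr 1
    funext k
    by_cases hk : k = M.tm.k₀
    · subst hk
      rw [Function.update_self, unaryEncodeNat_eq_replicate, List.map_replicate, List.append_nil]
      exact dif_pos rfl
    · rw [Function.update_of_ne hk]
      exact dif_neg hk
  have o4 : Turing.haltList M.tm (List.map M.outputAlphabet.invFun
      (Computability.unaryEncodeNat (f n))) = ⟨none, M.tm.initialState,
        Function.update (fun _ => []) M.tm.k₁
          (List.replicate (f n) (M.outputAlphabet.symm true))⟩ := by
    unfold Turing.haltList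
    congr 1
    funext k
    by_cases hk : k = M.tm.k₁
    · subst hk
      rw [Function.update_self, unaryEncodeNat_eq_replicate, List.map_replicate]
      exact dif_pos rfl
    · rw [Function.update_of_ne hk]
      exact dif_neg hk
  rw [i4, o4] at h4
  have r4 := call_runs h4 (Function.update (0 : R → ℕ) rn n) [] []
  have r5 := drain_runs (σ := M.tm.σ) (A := IOAlphabet M.tm.Γ) (.inl M.tm.k₁) rw
    (Function.update (0 : R → ℕ) rn n) (ioState (Function.update (fun _ => []) M.tm.k₁
          (List.replicate (f n) (M.outputAlphabet.symm true))) [] [])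
  have e5 : Function.update (Function.update (fun _ => []) M.tm.k₁
      (List.replicate (f n) (M.outputAlphabet.symm true))) M.tm.k₁ [] = fun _ => [] := by
    rw [Function.update_idem, Function.update_eq_self_iff]
  rw [update_ioState_inl, e5,
    show (ioState (Function.update (fun _ => []) M.tm.k₁
      (List.replicate (f n) (M.outputAlphabet.symm true))) [] [] (.inl M.tm.k₁) :
      List (IOAlphabet M.tm.Γ (.inl M.tm.k₁))).length = f n by
      simp [ioState],
    Function.update_of_ne hwn, show (0 : R → ℕ) rw + f n = f n from zero_add _,
    Function.update_comm hwn.symm] at r5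
  refine ((((r1.seq r2).seq r3).seq r4).seq r5).mono ?_
  have := hb n
  simp only [unaryEncodeNat_eq_replicate, List.length_replicate, eval_add, eval_mul, eval_X,
    eval_ofNat, eval_one] at ht' ⊢
  omega

/-! ### The explicit distinguishers -/

theorem counterPoly_numCols (c : ℕ) :
    CounterPoly fun v : Fin 2 → ℕ => numCols (fieldSize c (v 1)) (v 0) (v 1) :=
  .numCols (.fieldSize c (.proj 1)) (.proj 0) (.proj 1)

theorem counterPoly_matrixEntry (c : ℕ) :
    CounterPoly fun v : Fin 4 → ℕ => matrixEntry (fieldSize c (v 1))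
      (fieldModulus (fieldSize c (v 1))) (v 0) (v 1) (v 2) (v 3) :=
  have h := CounterPoly.fieldSize c (.proj (1 : Fin 4))
  .matrixEntry h (.fieldModulus h) (.proj 0) (.proj 1) (.proj 2) (.proj 3)

/-- The matrices are computable as soon as their two parameters can be read from the input. -/
theorem InputPhase.nonempty_designMatrix {α Y : Type} [DecidableEq Y] [Fintype Y]
    {B : Y → Type} {σ : Type} [Fintype σ] (v₀ : σ) {ea : α → List Bool} {w n : α → ℕ}
    (h : InputPhase B σ ea w n) {b : Polynomial ℕ} (hb : ∀ a, w a + n a ≤ b.eval (ea a).length)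
    (c : ℕ) :
    Nonempty (Turing.TM2ComputableInPolyTime ea encodeBinMatrix fun a =>
      ⟨n a, numCols (fieldSize c (n a)) (w a) (n a), designMatrix (fieldSize c (n a))
        (fieldModulus (fieldSize c (n a))) (w a) (n a)⟩) :=
  h.nonempty_computableInPolyTime v₀ hb (counterPoly_numCols c) (counterPoly_matrixEntry c)
    fun _ => matrixEntry_le_one _ _ _ _ _ _

theorem matrixPolyTime₂_designMatrix (c : ℕ) :
    MatrixPolyTime₂ fun p => ⟨p.2, numCols (fieldSize c p.2) p.1 p.2,
      designMatrix (fieldSize c p.2) (fieldModulus (fieldSize c p.2)) p.1 p.2⟩ :=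
  inputPhase_encodeUnaryPair.nonempty_designMatrix () (b := Polynomial.X) (fun p => by
    simp [encodeUnaryPair, unaryEncodeNat_eq_replicate]) c

theorem ceil_two_mul_rpow_le {ε : ℝ} (h0 : 0 < ε) (h1 : ε ≤ 1) (n : ℕ) :
    ⌈2 * (n : ℝ) ^ ε⌉₊ ≤ 2 * n := by
  refine Nat.ceil_le.2 ?_
  rcases Nat.eq_zero_or_pos n with rfl | hn
  · simp [Real.zero_rpow h0.ne']
  · have hle : (n : ℝ) ^ ε ≤ n := by
      conv_rhs => rw [← Real.rpow_one (n : ℝ)]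
      exact Real.rpow_le_rpow_of_exponent_le (by exact_mod_cast hn) h1
    push_cast
    linarith

theorem matrixPolyTime_designMatrix {ε : ℝ} (h0 : 0 < ε) (h1 : ε ≤ 1)
    (h : (∃ q : ℚ, ε = (q : ℝ)) ∨ NatPolyTime (fun n => ⌈2 * (n : ℝ) ^ ε⌉₊)) (c : ℕ) :
    MatrixPolyTime fun n => ⟨n, numCols (fieldSize c n) ⌈2 * (n : ℝ) ^ ε⌉₊ n,
      designMatrix (fieldSize c n) (fieldModulus (fieldSize c n)) ⌈2 * (n : ℝ) ^ ε⌉₊ n⟩ := by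
  have hb : ∀ n : ℕ, ⌈2 * (n : ℝ) ^ ε⌉₊ + n ≤
      (3 * Polynomial.X : Polynomial ℕ).eval (Computability.unaryEncodeNat n).length := by
    intro n
    have := ceil_two_mul_rpow_le h0 h1 n
    simp only [unaryEncodeNat_eq_replicate, List.length_replicate, Polynomial.eval_mul,
      Polynomial.eval_ofNat, Polynomial.eval_X]
    omega
  rcases h with ⟨q, rfl⟩ | ⟨⟨M⟩⟩
  · exact (inputPhase_of_counterPoly (CounterPoly.ceil_two_mul_rpow (by exact_mod_cast h0)
      (by exact_mod_cast h1))).nonempty_designMatrix () hb c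
  · have := M.tm.kFin
    have := M.tm.σFin
    exact (inputPhase_of_computableInPolyTime M (2 * Polynomial.X) fun n => by
      simpa using ceil_two_mul_rpow_le h0 h1 n).nonempty_designMatrix M.tm.initialState hb c

/-- With a single row, the matrix is `(1)`. -/
theorem isDistinguisher_designMatrix_one (q h w : ℕ) {ε δ : ℝ} (hε : 0 < ε) (hδ : δ ≤ 1) :
    IsDistinguisher (designMatrix q h w 1) ε δ := by
  intro x y hxy
  have hx : x 0 ≠ y 0 := fun hx => by
    have : x = y := funext fun i => by rw [Subsingleton.elim i 0, hx]
    rw [this, hammingDist_self] at hxy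
    norm_num at hxy
    linarith
  have hD : ∀ z : Fin 1 → ZMod 2, ∀ j, Matrix.vecMul z (designMatrix q h w 1) j = z 0 := by
    intro z j
    simp [Matrix.vecMul, dotProduct, designMatrix, matrixEntry]
  have hd : hammingDist (Matrix.vecMul x (designMatrix q h w 1))
      (Matrix.vecMul y (designMatrix q h w 1)) = numCols q w 1 := by
    unfold hammingDist
    simp [hD, hx]
  rw [hd]
  exact mul_le_of_le_one_left (Nat.cast_nonneg _) hδ

theorem mainTheorem5 :
    -- explicit distinguishers with parameter `n ^ (-ε)`
    (∀ ε : ℝ, 0 < ε → ε ≤ 1 →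
      ((∃ q : ℚ, ε = (q : ℝ)) ∨ NatPolyTime (fun n => ⌈2 * (n : ℝ) ^ ε⌉₊)) →
      ∃ (m : ℕ → ℕ) (D : ∀ n : ℕ, Matrix (Fin n) (Fin (m n)) (ZMod 2)),
        MatrixPolyTime (fun n => ⟨n, m n, D n⟩) ∧
        ∀ n : ℕ, 1 ≤ n →
          1 ≤ m n ∧ m n ≤ n ^ 7 ∧
          IsDistinguisher (D n) ((n : ℝ) ^ (-ε)) (1 / 8) ∧
          columnWeight (D n) ≤ ⌈2 * (n : ℝ) ^ ε⌉₊) ∧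
    -- existence for general parameters
    (∃ N : ℕ, ∀ w n : ℕ, N ≤ w → N ≤ n →
      ∀ ε δ : ℝ, 0 < ε → 0 < δ → δ ≤ (1 - 1 / (ε * (w : ℝ))) / 4 →
        ∃ m : ℕ, 1 ≤ m ∧ m ≤ n ^ 7 ∧
          ∃ D : Matrix (Fin n) (Fin m) (ZMod 2),
            IsDistinguisher D ε δ ∧ columnWeight D ≤ w) ∧
    -- explicitness for general parameters, with one matrix for all `ε` and `δ`
    (∃ (N : ℕ) (m : ℕ → ℕ → ℕ) (D : ∀ w n : ℕ, Matrix (Fin n) (Fin (m w n)) (ZMod 2)),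
      MatrixPolyTime₂ (fun p => ⟨p.2, m p.1 p.2, D p.1 p.2⟩) ∧
      ∀ w n : ℕ, N ≤ w → w < n →
        1 ≤ m w n ∧ m w n ≤ n ^ 7 ∧ columnWeight (D w n) ≤ w ∧
        ∀ ε δ : ℝ, 0 < ε → 0 < δ → δ ≤ (1 - 1 / (ε * (w : ℝ))) / 4 →
          IsDistinguisher (D w n) ε δ) := by
  refine ⟨fun ε h0 h1 h => ⟨_, _, matrixPolyTime_designMatrix h0 h1 h 2, fun n hn => ?_⟩,
    ⟨16, fun w n hw hn ε δ hε _ h => ⟨_, numCols_pos (by norm_num) (by omega), numCols_four_le hn, _,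
      isDistinguisher_of_le_quarter hε (by omega) (by omega) h,
      columnWeight_designMatrix_le _ _ _ _ (by omega)⟩⟩,
    ⟨16, _, fun w n => designMatrix (fieldSize 4 n) (fieldModulus (fieldSize 4 n)) w n,
      matrixPolyTime₂_designMatrix 4, fun w n hw hn =>
      ⟨numCols_pos (by norm_num) (by omega), numCols_four_le (by omega),
        columnWeight_designMatrix_le _ _ _ _ (by omega), fun ε δ hε _ h =>
        isDistinguisher_of_le_quarter hε (by omega) (by omega) h⟩⟩⟩
  have hn0 : (0 : ℝ) < n := by exact_mod_cast hn
  have hw : 2 * (n : ℝ) ^ ε ≤ ⌈2 * (n : ℝ) ^ ε⌉₊ := Nat.le_ceil _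
  have hw1 : 1 ≤ ⌈2 * (n : ℝ) ^ ε⌉₊ := Nat.ceil_pos.2 (by positivity)
  refine ⟨numCols_pos le_rfl hn, ?_, ?_, columnWeight_designMatrix_le _ _ _ _ hw1⟩
  · refine numCols_two_le hn fun hwn => ?_
    -- for `n > 1` the weight bound is larger than `2`
    have h2 : 2 < ⌈2 * (n : ℝ) ^ ε⌉₊ := Nat.lt_ceil.2 (by
      have := Real.one_lt_rpow (x := n) (by exact_mod_cast (by omega : 1 < n)) h0
      push_cast
      linarith)
    omega
  · rcases hn.eq_or_lt with rfl | hn1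
    · exact isDistinguisher_designMatrix_one _ _ _ (by positivity) (by norm_num)
    · refine isDistinguisher_eighth hw1 hn1 (by positivity) ?_
      calc (2 : ℝ) = (n : ℝ) ^ (-ε) * (2 * (n : ℝ) ^ ε) := by
            rw [mul_left_comm, ← Real.rpow_add hn0, neg_add_cancel, Real.rpow_zero, mul_one]
        _ ≤ _ := mul_le_mul_of_nonneg_left hw (by positivity)
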